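/- \textbf{Theorem (Komatsu--Nakagawa representation of the stationary distribution).} \emph{Models.} Let $\mathcal S$ be a non-empty finite set and let $c(x,y)=c(y,x)\ge 0$ ($x\neq y$) be a connectivity function such that any two states are joined by a chain $x_0,\dots,x_n$ of states with $x_{j-1}\ne x_j$ and $c(x_{j-1},x_j)\neq 0$. Fix $\beta>0$, $\bar E>0$ and $\bar\epsilon>0$. Let $(H^\nu_x)_{x\in\mathcal S}$ be real Hamiltonians, indexed by a parameter $\nu$, with $|H^\nu_x|\le\bar E$, and let $\xi^\kappa_{x\to y}$ be real numbers, indexed by a parameter $\kappa$, with $|\xi^\kappa_{x\to y}|\le 1$ whenever $x\ne y$, $c(x,y)\neq 0$. For $\alpha=(\beta,\epsilon,\nu,\kappa)$ with $0\le\epsilon\le\bar\epsilon$ set, for $x\ne y$, $$R^\alpha_{x\to y}=e^{\epsilon\,\xi^\kappa_{x\to y}}R^{(\beta,\nu)}_{x\to y},$$ where, for one of the two choices fixed once and for all, $R^{(\beta,\nu)}_{x\to y}=c(x,y)e^{\beta H^\nu_x}$ or $R^{(\beta,\nu)}_{x\to y}=c(x,y)e^{(\beta/2)(H^\nu_x-H^\nu_y)}$.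 Put $\lambda^\alpha_x=\sum_{y\ne x}R^\alpha_{x\to y}$. \emph{Paths.} A path on $[a,b]$ is $\hat x=(n,(x_0,\dots,x_n),(t_1,\dots,t_n))$ with $x_{j-1}\neq x_j$ and $a<t_1<\dots<t_n<b$; put $t_0=a$, $t_{n+1}=b$. Its weight is $\mathcal T^\alpha[\hat x]=\prod_{j=1}^nR^\alpha_{x_{j-1}\to x_j}\prod_{j=0}^n e^{-(t_{j+1}-t_j)\lambda^\alpha_{x_j}}$, and $\int\mathcal D\hat x$ denotes the sum over $n\ge 0$ and over $x_0,\dots,x_n$ with $x_{j-1}\ne x_j$ of the integrals $\int_a^b dt_1\int_{t_1}^b dt_2\cdots\int_{t_{n-1}}^b dt_n$. For a probability distribution $\rho^\alpha$ on $\mathcal S$ and a function $f$ of the path let $$\langle f\rangle_{x\to}=\int\mathcal D\hat x\,f[\hat x]\,\delta_{x_0,x}\,\mathcal T^\alpha[\hat x],\qquad [f]_{\mathrm{st}\to x}=\int\mathcal D\hat x\,f[\hat x]\,\rho^\alpha_{x_0}\,\delta_{x_n,x}\,\mathcal T^\alpha[\hat x],\qquad \langle f\rangle_{\mathrm{st}\to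 x}=\frac{[f]_{\mathrm{st}\to x}}{\rho^\alpha_x},$$ with a superscript $\tau$ when the time interval is $[-\tau,\tau]$ and with the interval as superscript otherwise. Let $\theta^\alpha_{x\to y}=\log(R^\alpha_{x\to y}/R^\alpha_{y\to x})$, let $\psi^\alpha_{x\to y}=\theta^\alpha_{x\to y}-\beta(H^\nu_x-H^\nu_y)$ be the nonequilibrium part of the entropy production, and let $\Psi[\hat x]=\sum_{j=1}^n\psi^\alpha_{x_{j-1}\to x_j}$. \emph{Claim.} There is a constant $C_0>0$, depending only on $\mathcal S$, $c$, the choice of the equilibrium rates, $\beta$, $\bar E$ and $\bar\epsilon$, such that the following holds for all such $\alpha=(\beta,\epsilon,\nu,\kappa)$. There is a unique stationary probability distribution $\rho^\alpha=(\rho^\alpha_x)_{x\in\mathcal S}$ of the Markov jump process with rates $R^\alpha$; it satisfies $\rho^\alpha_x>0$ for all $x$. There is a real number $F(\alpha)$, the nonequilibrium free energy, such that for every $x\in\mathcal S$ the limit on the right exists and $$e^{-\beta F(\alpha)}=e^{-\beta H^\nu_x}\lim_{\tau\uparrow\infty}\frac{\langle e^{-\Psi/2}\rangle^{[-\tau,-\tau/2]}_{x\to}}{[e^{-\Psi/2}]^{[\tau/2,\tau]}_{\mathrm{st}\to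 x}} .$$ For every $x\in\mathcal S$ the limit in the following formula exists in $\mathbb R$, and $$\left|\log\rho^\alpha_x-\left\{\beta F(\alpha)-\beta H^\nu_x-\frac12\lim_{\tau\uparrow\infty}\Bigl\{\langle\Psi\rangle^{\tau}_{x\to}-\langle\Psi\rangle^{\tau}_{\mathrm{st}\to x}\Bigr\}\right\}\right|\le C_0\,\epsilon^3 .$$ -/

import Mathlib

open Filter Topology

noncomputable section

namespace NESS

/-! ### Paths -/

section Paths

variable {S : Type*}

/-- A history of jumps `(n, (x_0, …, x_n), (t_1, …, t_n))`.  Here `state j = x_j` and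
`time j = t_{j+1}`. The constraints on the states and times (consecutive states are different,
times are increasing) are imposed by the domain of the path integral below. -/
structure JumpPath (S : Type*) where
  jumps : ℕ
  state : Fin (jumps + 1) → S
  time : Fin jumps → ℝ

/-- The initial state of a path. -/
def JumpPath.first (p : JumpPath S) : S := p.state 0

/-- The final state of a path. -/
def JumpPath.last (p : JumpPath S) : S := p.state (Fin.last p.jumps)

/-- The jump times completed by the end points `t_0 = a` and `t_{n+1} = b` of the interval. -/
def JumpPath.fullTime (p : JumpPath S) (a b : ℝ) : Fin (p.jumps + 2) → ℝ :=
  Fin.cons a (Fin.snoc p.time b : Fin (p.jumps + 1) → ℝ)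

/-- The sum over all the jumps of a path of a quantity `ψ_{x→y}` attached to the jumps,
`Ψ[x̂] = ∑_{j=1}^n ψ_{x_{j-1}→x_j}`. -/
def JumpPath.total (ψ : S → S → ℝ) (p : JumpPath S) : ℝ :=
  ∑ j : Fin p.jumps, ψ (p.state j.castSucc) (p.state j.succ)

/-- The iterated integral `∫_a^b dt_1 ∫_{t_1}^b dt_2 ⋯ ∫_{t_{n-1}}^b dt_n g(t_1, …, t_n)`. -/
def orderedIntegral (b : ℝ) : (n : ℕ) → (a : ℝ) → ((Fin n → ℝ) → ℝ) → ℝ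
  | 0, _, g => g Fin.elim0
  | n + 1, a, g => ∫ t in a..b, orderedIntegral b n t fun s => g (Fin.cons t s)

end Paths

/-! ### Markov jump processes on a finite state space

`R x y` is the transition rate from `x` to `y`; only its values at `x ≠ y` are ever used. -/

section MarkovJump

variable {S : Type*} [Fintype S] [DecidableEq S]

/-- The escape rate `λ_x = ∑_{y ≠ x} R_{x→y}`. -/
def escapeRate (R : S → S → ℝ) (x : S) : ℝ :=
  ∑ y ∈ Finset.univ.erase x, R x y

/-- The transition rate matrix: entry `(y, x)` is `R_{x→y}` for `x ≠ y` and `-λ_x` for `x = y`,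
so that the master equation is `dp/dt = rateMatrix R *ᵥ p`. -/
def rateMatrix (R : S → S → ℝ) : Matrix S S ℝ :=
  Matrix.of fun y x => if x = y then -escapeRate R x else R x y

/-- `ρ` is a stationary probability distribution of the process with rates `R`. -/
structure IsStationaryDistribution (R : S → S → ℝ) (ρ : S → ℝ) : Prop where
  nonneg : ∀ x, 0 ≤ ρ x
  sum_eq_one : ∑ x, ρ x = 1
  stationary : (rateMatrix R).mulVec ρ = 0

/-- The weight (transition probability density) of a path on `[a, b]` for time-independent rates,
`∏_{j=1}^n R_{x_{j-1}→x_j} ∏_{j=0}^n exp (-(t_{j+1} - t_j) λ_{x_j})`. -/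
def JumpPath.weight (R : S → S → ℝ) (a b : ℝ) (p : JumpPath S) : ℝ :=
  (∏ j : Fin p.jumps, R (p.state j.castSucc) (p.state j.succ)) *
    ∏ j : Fin (p.jumps + 1),
      Real.exp (-((p.fullTime a b j.succ - p.fullTime a b j.castSucc) *
        escapeRate R (p.state j)))

/-- The integral over all paths on the time interval `[a, b]`: the sum over the number `n` of
jumps, the sum over all `x_0, …, x_n` with `x_{j-1} ≠ x_j`, and the ordered integral over the
jump times. -/
def pathIntegral (a b : ℝ) (f : JumpPath S → ℝ) : ℝ :=
  ∑' n : ℕ, ∑ xs : Fin (n + 1) → S with (∀ j : Fin n, xs j.castSucc ≠ xs j.succ),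
    orderedIntegral b n a fun ts => f ⟨n, xs, ts⟩

/-- The expectation `⟨f⟩_{x→}` on `[a, b]` of a function of the path, started from `x`. -/
def expFrom (R : S → S → ℝ) (a b : ℝ) (x : S) (f : JumpPath S → ℝ) : ℝ :=
  pathIntegral a b fun p => f p * (if p.first = x then 1 else 0) * p.weight R a b

/-- The unnormalized expectation `[f]_{st→y}` on `[a, b]`: the initial state is drawn from `ρ`,
and the final state is `y`. -/
def unnormExpStTo (R : S → S → ℝ) (ρ : S → ℝ) (a b : ℝ) (y : S) (f : JumpPath S → ℝ) : ℝ :=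
  pathIntegral a b fun p => f p * ρ p.first * (if p.last = y then 1 else 0) * p.weight R a b

/-- The conditional expectation `⟨f⟩_{st→y} = [f]_{st→y} / ρ_y` on `[a, b]`. -/
def expStTo (R : S → S → ℝ) (ρ : S → ℝ) (a b : ℝ) (y : S) (f : JumpPath S → ℝ) : ℝ :=
  unnormExpStTo R ρ a b y f / ρ y

end MarkovJump

/-! ### Entropy production and free energy -/

section Thermodynamics

variable {S : Type*}

/-- The entropy production `θ_{x→y} = log (R_{x→y} / R_{y→x})` in the baths. It is meaningful
where `R_{x→y} ≠ 0`; paths with other jumps have weight zero. -/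
def entropyProduction (R : S → S → ℝ) (x y : S) : ℝ :=
  Real.log (R x y / R y x)

/-- The nonequilibrium part `ψ_{x→y} = θ_{x→y} - β (H_x - H_y)` of the entropy production. -/
def noneqEntropyProduction (R : S → S → ℝ) (β : ℝ) (H : S → ℝ) (x y : S) : ℝ :=
  entropyProduction R x y - β * (H x - H y)

/-- The nonequilibrium part `Ψ[x̂]` of the total entropy production in a path. -/
def Psi (R : S → S → ℝ) (β : ℝ) (H : S → ℝ) (p : JumpPath S) : ℝ :=
  p.total (noneqEntropyProduction R β H)

variable [Fintype S] [DecidableEq S]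

/-- `F` is the nonequilibrium free energy: for every state `x`,
`exp (-β F) = exp (-β H_x) lim_{τ→∞} ⟨exp (-Ψ/2)⟩_{x→}^{[-τ,-τ/2]} / [exp (-Ψ/2)]_{st→x}^{[τ/2,τ]}`.
-/
def IsFreeEnergy (R : S → S → ℝ) (β : ℝ) (H ρ : S → ℝ) (F : ℝ) : Prop :=
  ∀ x : S, Tendsto
    (fun τ : ℝ => Real.exp (-β * H x) *
      (expFrom R (-τ) (-τ / 2) x (fun p => Real.exp (-Psi R β H p / 2)) /
        unnormExpStTo R ρ (τ / 2) τ x (fun p => Real.exp (-Psi R β H p / 2))))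
    atTop (𝓝 (Real.exp (-β * F)))

end Thermodynamics

/-! ### The class of models -/

section Models

variable {S : Type*}

/-- `c` is a connectivity function: symmetric and nonnegative at distinct states, and any state
can be reached from any other one through pairs of distinct states at which `c` does not vanish. -/
structure IsConnectivity (c : S → S → ℝ) : Prop where
  symm : ∀ x y, x ≠ y → c x y = c y x
  nonneg : ∀ x y, x ≠ y → 0 ≤ c x y
  connected : ∀ x y, Relation.ReflTransGen (fun u v => u ≠ v ∧ c u v ≠ 0) x y

/-- The two standard choices of the equilibrium dynamics. -/
inductive EqRule
  | exponential
  | symmetric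

/-- The rates of the equilibrium dynamics: `c(x,y) exp (β H_x)` or
`c(x,y) exp ((β/2) (H_x - H_y))`. -/
def eqRate (rule : EqRule) (c : S → S → ℝ) (β : ℝ) (H : S → ℝ) (x y : S) : ℝ :=
  match rule with
  | .exponential => c x y * Real.exp (β * H x)
  | .symmetric => c x y * Real.exp (β / 2 * (H x - H y))

/-- The nonequilibrium rates `exp (ε ξ_{x→y}) R^eq_{x→y}`. -/
def rate (rule : EqRule) (c : S → S → ℝ) (β ε : ℝ) (H : S → ℝ) (ξ : S → S → ℝ) (x y : S) : ℝ :=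
  Real.exp (ε * ξ x y) * eqRate rule c β H x y

end Models

end NESS

end

noncomputable section

namespace NESS

/-! ### Path integrals as Dyson series of linear evolution equations -/

section PathSums

/-! The formula is an exact identity followed by a perturbation expansion in which a time-reversal
symmetry removes the second-order error.

Exact identity. Let k be the rates off the diagonal and K_xy = k_xy exp(-ψ_xy/2). With π = exp(-βH),
local detailed balance reads π_x k_xy exp(-ψ_xy) = π_y k_yx. Since ψ is antisymmetric, π_x K_xy is
therefore symmetric. So K minus the escape rates has a positive right Perron eigenvector l, with
eigenvalue μ, and its left eigenvector is r = πl/Z, where Z = Σ πl. By the Dyson series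
(`hasSum_of_duhamel`) a path integral of exp(-Ψ/2) solves the linear equation generated by this
matrix. A Doob transform (`exists_tilted_flow`) gives its asymptotics, and `tendsto_ratio` then
yields exp(-βF) = Z, with l normalised by Σ ρl = 1 and r by Σ r = 1. Put q = r/ρ. Then log ρ_x = βF
- βH_x + log l_x - log q_x without any error, and q is the Perron eigenvector of the same problem
for the time-reversed process, with rates ρ_y k_yx/ρ_x and with ψ_yx in place of ψ_xy.

Mean entropy production. Let V and U be the centred solutions of the Poisson equations for the mean
rates of entropy production of the process and of its reversal. The two conditional expectations of
Ψ share a linearly growing term, and their difference tends to V_x - U_x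
(`tendsto_expFrom_sub_expStTo`).

Expansion. Since ψ = O(ε), one has l = 1 - V/2 + l₂ and q = 1 - U/2 + q₂ with l₂, q₂ = O(ε²)
(`exists_expansion`). The reversed rates differ from k by O(ε) and ψ changes sign, so V + U = O(ε²).
The sources of l₂ and q₂ are even under reversal to leading order, so l₂ - q₂ = O(ε³). Likewise the
squares of l - 1 and q - 1 agree to third order. Hence log l - log q = -(V - U)/2 + O(ε³)
(`exists_cubic_bound`).

Uniformity. All constants come from comparing the rates with c: a Harnack inequality
(`exists_harnack`) and an oscillation bound for the generator (`exists_osc_bound`), both obtained by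
following chains of c. -/

lemma continuous_integral_exp_mul (b l : ℝ) {g : ℝ → ℝ} (hg : Continuous g) :
    Continuous fun a : ℝ => ∫ t in a..b, Real.exp (-((t - a) * l)) * g t := by
  have h : (fun a : ℝ => ∫ t in a..b, Real.exp (-((t - a) * l)) * g t) =
      fun a => Real.exp (a * l) * -∫ t in b..a, Real.exp (-(t * l)) * g t := by
    funext a
    rw [← intervalIntegral.integral_symm, ← intervalIntegral.integral_const_mul]
    congr 1
    funext t
    rw [← mul_assoc, ← Real.exp_add]
    ring_nf
  rw [h]
  have hc : Continuous fun t => Real.exp (-(t * l)) * g t := by fun_prop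
  have := intervalIntegral.continuous_primitive 
    (fun x y => hc.intervalIntegrable (μ := MeasureTheory.volume) x y) b
  fun_prop

/-- Convergence of the Dyson series: the iterated integrals `A n` sum up to the solution `E` of
the backward equation. -/
theorem hasSum_of_duhamel {ι : Type*} [Fintype ι] {lam : ι → ℝ} (hlam : ∀ i, 0 ≤ lam i)
    (B : ι → ι → ℝ) (χ : ι → ℝ) (b : ℝ) {A : ℕ → ℝ → ι → ℝ}
    (hA0 : ∀ a i, A 0 a i = Real.exp (-((b - a) * lam i)) * χ i)
    (hA : ∀ n a i, A (n + 1) a i =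
      ∫ t in a..b, Real.exp (-((t - a) * lam i)) * ∑ j, B i j * A n t j)
    {E : ℝ → ι → ℝ} (hE0 : ∀ i, E 0 i = χ i)
    (hE : ∀ t i, HasDerivAt (fun t => E t i) (∑ j, B i j * E t j - lam i * E t i) t)
    {a : ℝ} (hab : a ≤ b) (i : ι) : HasSum (fun n => A n a i) (E (b - a) i) := by
  have hAc : ∀ n i, Continuous fun a => A n a i := by
    intro n
    induction n with
    | zero => intro i; simp only [hA0]; fun_prop
    | succ n ih =>
      intro i
      simp only [hA]
      exact continuous_integral_exp_mul b (lam i)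
        (continuous_finsetSum _ fun j _ => continuous_const.mul (ih j))
  have hEc : ∀ i, Continuous fun t => E t i := fun i =>
    continuous_iff_continuousAt.2 fun t => (hE t i).continuousAt
  -- Duhamel's formula: integrate the derivative of -exp(-(t-a)λ_i) E_i(b-t) over [a, b].
  have hEint : ∀ a i, E (b - a) i = Real.exp (-((b - a) * lam i)) * χ i +
      ∫ t in a..b, Real.exp (-((t - a) * lam i)) * ∑ j, B i j * E (b - t) j := by
    intro a i
    have hd : ∀ t, HasDerivAt (fun t => -(Real.exp (-((t - a) * lam i)) * E (b - t) i))
        (Real.exp (-((t - a) * lam i)) * ∑ j, B i j * E (b - t) j) t := by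
      intro t
      have h1 : HasDerivAt (fun t : ℝ => Real.exp (-((t - a) * lam i)))
          (Real.exp (-((t - a) * lam i)) * -(1 * lam i)) t :=
        ((((hasDerivAt_id t).sub_const a).mul_const (lam i)).neg).exp
      have h2 : HasDerivAt (fun t : ℝ => E (b - t) i)
          (-(∑ j, B i j * E (b - t) j - lam i * E (b - t) i)) t :=
        (hE (b - t) i).comp_const_sub b t
      convert! (h1.mul h2).neg using 1
      ring
    have hc : Continuous fun t =>
        Real.exp (-((t - a) * lam i)) * ∑ j, B i j * E (b - t) j := by
      refine Continuous.mul (by fun_prop) (continuous_finsetSum _ fun j _ =>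
        continuous_const.mul ((hEc j).comp (by fun_prop)))
    rw [intervalIntegral.integral_eq_sub_of_hasDerivAt (fun t _ => hd t)
      (hc.intervalIntegrable _ _)]
    simp [hE0]
  -- the remainder
  obtain ⟨C, hC0, hC⟩ : ∃ C : ℝ, 0 ≤ C ∧ ∀ t ∈ Set.Icc a b, ∀ i, |E (b - t) i| ≤ C := by
    have h1 : Continuous fun t => ∑ i, |E (b - t) i| :=
      continuous_finsetSum _ fun i _ => ((hEc i).comp (by fun_prop)).abs
    obtain ⟨C, hC⟩ := (isCompact_Icc (a := a) (b := b)).exists_bound_of_continuousOn h1.continuousOn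
    refine ⟨C, (norm_nonneg _).trans (hC a ⟨le_rfl, hab⟩), fun t ht i => ?_⟩
    refine le_trans ?_ ((le_abs_self _).trans (hC t ht))
    exact Finset.single_le_sum (f := fun i => |E (b - t) i|) (fun i _ => abs_nonneg _)
      (Finset.mem_univ i)
  set K : ℝ := ∑ i, ∑ j, |B i j| with hK
  have hK0 : 0 ≤ K := Finset.sum_nonneg fun i _ => Finset.sum_nonneg fun j _ => abs_nonneg _
  set Rem : ℕ → ℝ → ι → ℝ := fun n t i => E (b - t) i - ∑ k ∈ Finset.range n, A k t i with hRem
  have hRemS : ∀ n t i, Rem (n + 1) t i =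
      ∫ s in t..b, Real.exp (-((s - t) * lam i)) * ∑ j, B i j * Rem n s j := by
    intro n t i
    simp only [hRem]
    rw [Finset.sum_range_succ', hA0, hEint t i]
    have h3 : ∀ k, IntervalIntegrable (fun s => Real.exp (-((s - t) * lam i)) *
        ∑ j, B i j * A k s j) MeasureTheory.volume t b := fun k => by
      refine Continuous.intervalIntegrable (Continuous.mul (by fun_prop)
        (continuous_finsetSum _ fun j _ => continuous_const.mul (hAc k j))) _ _
    have h4 : IntervalIntegrable (fun s => Real.exp (-((s - t) * lam i)) *
        ∑ j, B i j * E (b - s) j) MeasureTheory.volume t b := by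
      refine Continuous.intervalIntegrable (Continuous.mul (by fun_prop)
        (continuous_finsetSum _ fun j _ => continuous_const.mul
          ((hEc j).comp (by fun_prop)))) _ _
    simp only [hA]
    rw [← intervalIntegral.integral_finsetSum (fun k _ => h3 k)]
    have h5 : IntervalIntegrable (fun s => ∑ k ∈ Finset.range n,
        Real.exp (-((s - t) * lam i)) * ∑ j, B i j * A k s j) MeasureTheory.volume t b := by
      have := IntervalIntegrable.sum (Finset.range n) (fun k _ => h3 k)
      convert! this using 1
      funext s
      simp
    rw [add_comm (∫ s in t..b, ∑ k ∈ Finset.range n, _), add_sub_add_left_eq_sub,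
      ← intervalIntegral.integral_sub h4 h5]
    congr 1
    funext s
    rw [← Finset.mul_sum, ← mul_sub]
    congr 1
    simp only [mul_sub, Finset.sum_sub_distrib]
    congr 1
    rw [Finset.sum_comm]
    simp [Finset.mul_sum]
  -- The remainders obey the recursion of the terms `A n`, started from E instead of from `A 0`. As
  -- λ ≥ 0 the exponentials are at most 1, so each step costs a factor K and one integration, which
  -- produces the factorial.
  have hbound : ∀ n, ∀ t ∈ Set.Icc a b, ∀ i,
      |Rem n t i| ≤ C * (K * (b - t)) ^ n / n.factorial := by
    intro n
    induction n with
    | zero => intro t ht i; simpa [hRem] using hC t ht i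
    | succ n ih =>
      intro t ht i
      rw [hRemS]
      have hptw : ∀ s ∈ Set.Ioc t b, ‖Real.exp (-((s - t) * lam i)) * ∑ j, B i j * Rem n s j‖ ≤
          C * K ^ (n + 1) / n.factorial * (b - s) ^ n := by
        intro s hs
        have hs' : s ∈ Set.Icc a b := ⟨ht.1.trans hs.1.le, hs.2⟩
        rw [norm_mul, Real.norm_eq_abs, Real.norm_eq_abs, Real.abs_exp]
        have e1 : Real.exp (-((s - t) * lam i)) ≤ 1 := by
          rw [Real.exp_le_one_iff]
          have := mul_nonneg (sub_nonneg.2 hs.1.le) (hlam i)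
          linarith
        have hnn : 0 ≤ C * (K * (b - s)) ^ n / n.factorial := by
          have := sub_nonneg.2 hs.2
          positivity
        calc _ ≤ 1 * ∑ j, |B i j * Rem n s j| :=
              mul_le_mul e1 (Finset.abs_sum_le_sum_abs _ _) (abs_nonneg _) zero_le_one
          _ ≤ 1 * ∑ j, |B i j| * (C * (K * (b - s)) ^ n / n.factorial) := by
              gcongr with j _
              rw [abs_mul]
              exact mul_le_mul_of_nonneg_left (ih s hs' j) (abs_nonneg _)
          _ = (∑ j, |B i j|) * (C * (K * (b - s)) ^ n / n.factorial) := by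
              rw [one_mul, ← Finset.sum_mul]
          _ ≤ K * (C * (K * (b - s)) ^ n / n.factorial) := by
              gcongr
              exact Finset.single_le_sum (f := fun i => ∑ j, |B i j|)
                (fun i _ => Finset.sum_nonneg fun j _ => abs_nonneg _) (Finset.mem_univ i)
          _ = _ := by rw [mul_pow]; ring
      have hint : ∫ s in t..b, C * K ^ (n + 1) / n.factorial * (b - s) ^ n =
          C * (K * (b - t)) ^ (n + 1) / (n + 1).factorial := by
        rw [intervalIntegral.integral_const_mul,
          intervalIntegral.integral_comp_sub_left (fun x => x ^ n) b]
        simp only [sub_self, integral_pow, Nat.factorial_succ]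
        push_cast
        simp only [mul_pow, zero_pow (Nat.succ_ne_zero n), sub_zero]
        field_simp
      rw [← hint, ← Real.norm_eq_abs]
      refine intervalIntegral.norm_integral_le_of_norm_le ht.2
        (Filter.Eventually.of_forall fun s hs => hptw s hs) ?_
      exact Continuous.intervalIntegrable (by fun_prop) _ _
  have hlim : Tendsto (fun n : ℕ => C * ((K * (b - a)) ^ n / n.factorial)) atTop (𝓝 0) := by
    simpa using (FloorSemiring.tendsto_pow_div_factorial_atTop (K * (b - a))).const_mul C
  have hta : a ∈ Set.Icc a b := ⟨le_rfl, hab⟩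
  have hsumm : Summable fun n => A n a i := by
    have hs := (Real.summable_pow_div_factorial (K * (b - a))).mul_left C
    refine Summable.of_norm_bounded (hs.add ((summable_nat_add_iff 1).2 hs)) fun n => ?_
    have : A n a i = Rem n a i - Rem (n + 1) a i := by
      simp only [hRem, Finset.sum_range_succ]; ring
    rw [this]
    refine (norm_sub_le _ _).trans (add_le_add ?_ ?_)
    · simpa [mul_div_assoc] using hbound n a hta i
    · simpa [mul_div_assoc] using hbound (n + 1) a hta i
  have ht2 : Tendsto (fun n => ∑ k ∈ Finset.range n, A k a i) atTop (𝓝 (E (b - a) i)) := by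
    have h0 : Tendsto (fun n => Rem n a i) atTop (𝓝 0) := by
      refine squeeze_zero_norm (fun n => ?_) hlim
      simpa [mul_div_assoc] using hbound n a hta i
    have := h0.const_sub (E (b - a) i)
    simpa [hRem] using this
  have := tendsto_nhds_unique hsumm.hasSum.tendsto_sum_nat ht2
  rw [← this]
  exact hsumm.hasSum

/-- The time integral of the holding probabilities along a given sequence of states. -/
def holdIntegral {S : Type*} (lam : S → ℝ) (b : ℝ) : (n : ℕ) → (Fin (n + 1) → S) → ℝ → ℝ
  | 0, xs, a => Real.exp (-((b - a) * lam (xs 0)))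
  | n + 1, xs, a => ∫ t in a..b, Real.exp (-((t - a) * lam (xs 0))) *
      holdIntegral lam b n (Fin.tail xs) t

lemma continuous_holdIntegral {S : Type*} (lam : S → ℝ) (b : ℝ) (n : ℕ) (xs : Fin (n + 1) → S) :
    Continuous (holdIntegral lam b n xs) := by
  induction n with
  | zero =>
    show Continuous fun a => Real.exp (-((b - a) * lam (xs 0)))
    fun_prop
  | succ n ih => exact continuous_integral_exp_mul b _ (ih _)

/-- Only the first holding factor involves the outermost time alone. The induction moves it into the
constant, which is why `a` and `C` are generalised. -/
lemma orderedIntegral_exp {S : Type*} (lam : S → ℝ) (b : ℝ) (n : ℕ) (xs : Fin (n + 1) → S)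
    (a C : ℝ) :
    orderedIntegral b n a (fun ts => C * ∏ j : Fin (n + 1),
      Real.exp (-(((JumpPath.mk n xs ts).fullTime a b j.succ -
        (JumpPath.mk n xs ts).fullTime a b j.castSucc) * lam (xs j)))) =
      C * holdIntegral lam b n xs a := by
  induction n generalizing a C with
  | zero => simp [orderedIntegral, holdIntegral, JumpPath.fullTime, Fin.snoc]
  | succ n ih =>
    simp only [orderedIntegral, holdIntegral]
    rw [← intervalIntegral.integral_const_mul]
    congr 1
    funext t
    rw [← mul_assoc, ← ih (Fin.tail xs) t]
    congr 1
    funext s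
    rw [Fin.prod_univ_succ, ← mul_assoc]
    congr 1
    refine Finset.prod_congr rfl fun j _ => ?_
    simp only [JumpPath.fullTime, ← Fin.cons_snoc_eq_snoc_cons, Fin.cons_succ,
      ← Fin.succ_castSucc]
    rfl

/-- The product of a two-point function along the jumps of a sequence of states. -/
def jumpProd {S : Type*} (k : S → S → ℝ) {n : ℕ} (xs : Fin (n + 1) → S) : ℝ :=
  ∏ j : Fin n, k (xs j.castSucc) (xs j.succ)

/-- The sum of a two-point function along the jumps of a sequence of states. -/
def jumpSum {S : Type*} (ψ : S → S → ℝ) {n : ℕ} (xs : Fin (n + 1) → S) : ℝ :=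
  ∑ j : Fin n, ψ (xs j.castSucc) (xs j.succ)

lemma jumpProd_cons {S : Type*} (k : S → S → ℝ) {n : ℕ} (x : S) (ys : Fin (n + 1) → S) :
    jumpProd k (Fin.cons x ys : Fin (n + 2) → S) = k x (ys 0) * jumpProd k ys := by
  rw [jumpProd, Fin.prod_univ_succ]
  rfl

lemma jumpSum_cons {S : Type*} (ψ : S → S → ℝ) {n : ℕ} (x : S) (ys : Fin (n + 1) → S) :
    jumpSum ψ (Fin.cons x ys : Fin (n + 2) → S) = ψ x (ys 0) + jumpSum ψ ys := by
  rw [jumpSum, Fin.sum_univ_succ]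
  rfl

/-- The contribution of the paths with `n` jumps which start from `x`. -/
def pathSum {S : Type*} [Fintype S] (lam : S → ℝ) (b : ℝ) (w : (n : ℕ) → (Fin (n + 1) → S) → ℝ)
    (χ : S → ℝ) (n : ℕ) (a : ℝ) (x : S) : ℝ :=
  ∑ xs : Fin n → S, w n (Fin.cons x xs) *
    χ ((Fin.cons x xs : Fin (n + 1) → S) (Fin.last n)) *
    holdIntegral lam b n (Fin.cons x xs) a

variable {S : Type*} [Fintype S]

/-- The two-point function with its diagonal removed. -/
def offDiag [DecidableEq S] (k : S → S → ℝ) (x y : S) : ℝ := if x = y then 0 else k x y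

/-- Removing the diagonal of the rates kills every sequence with two equal consecutive states, so
the constrained sum over states becomes a free one and can be treated recursively. The functional
`m` sees the states only, so it comes out of the time integrals. -/
lemma pathIntegral_eq_tsum_pathSum [DecidableEq S] (R : S → S → ℝ) (a b : ℝ)
    (m : (n : ℕ) → (Fin (n + 1) → S) → ℝ) (α χ : S → ℝ) :
    pathIntegral a b (fun p => m p.jumps p.state * α p.first * χ p.last * p.weight R a b) =
      ∑' n, ∑ x, α x * pathSum (escapeRate R) b
        (fun _ xs => m _ xs * jumpProd (offDiag R) xs) χ n a x := by
  unfold pathIntegral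
  congr 1
  funext n
  rw [Finset.sum_filter, ← (Fin.consEquiv fun _ : Fin (n + 1) => S).sum_comp,
    Fintype.sum_prod_type]
  refine Finset.sum_congr rfl fun x _ => ?_
  rw [pathSum, Finset.mul_sum]
  refine Finset.sum_congr rfl fun xs _ => ?_
  set ys : Fin (n + 1) → S := Fin.cons x xs with hys
  have h1 : (Fin.consEquiv fun _ : Fin (n + 1) => S) (x, xs) = ys := rfl
  have h2 : α x = α (ys 0) := rfl
  rw [h1, h2]
  have h3 : jumpProd (offDiag R) ys = if (∀ j : Fin n, ys j.castSucc ≠ ys j.succ) then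
      ∏ j : Fin n, R (ys j.castSucc) (ys j.succ) else 0 := by
    split_ifs with h
    · exact Finset.prod_congr rfl fun j _ => by rw [offDiag, if_neg (h j)]
    · push Not at h
      obtain ⟨j, hj⟩ := h
      exact Finset.prod_eq_zero (Finset.mem_univ j) (by rw [offDiag, if_pos hj])
  rw [h3]
  split_ifs with h
  · have := orderedIntegral_exp (escapeRate R) b n ys a
      (m n ys * α (ys 0) * χ (ys (Fin.last n)) * ∏ j : Fin n, R (ys j.castSucc) (ys j.succ))
    simp only [JumpPath.weight, JumpPath.first, JumpPath.last]
    rw [show α (ys 0) * (m n ys * (∏ j : Fin n, R (ys j.castSucc) (ys j.succ)) *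
      χ (ys (Fin.last n)) * holdIntegral (escapeRate R) b n ys a) =
      m n ys * α (ys 0) * χ (ys (Fin.last n)) * (∏ j : Fin n, R (ys j.castSucc) (ys j.succ)) *
        holdIntegral (escapeRate R) b n ys a by ring, ← this]
    congr 1
    funext ts
    ring
  · simp

lemma pathSum_zero (lam : S → ℝ) (b : ℝ) (w : (n : ℕ) → (Fin (n + 1) → S) → ℝ)
    (χ : S → ℝ) (a : ℝ) (x : S) :
    pathSum lam b w χ 0 a x =
      Real.exp (-((b - a) * lam x)) * (w 0 (Fin.cons x Fin.elim0) * χ x) := by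
  have h0 : ∀ xs : Fin 0 → S, xs = Fin.elim0 := fun xs => Subsingleton.elim _ _
  simp [pathSum, holdIntegral, h0]
  ring

/-- Decomposition at the first jump: its time is the integration variable and its target is y. This
is the recursion required by `hasSum_of_duhamel`. -/
lemma pathSum_succ (lam : S → ℝ) (b : ℝ) (w : (n : ℕ) → (Fin (n + 1) → S) → ℝ)
    (χ : S → ℝ) (n : ℕ) (a : ℝ) (x : S) :
    pathSum lam b w χ (n + 1) a x = ∫ t in a..b, Real.exp (-((t - a) * lam x)) *
      ∑ y, pathSum lam b (fun k ys => w (k + 1) (Fin.cons x ys)) χ n t y := by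
  simp only [pathSum, Finset.mul_sum]
  rw [← (Fin.consEquiv fun _ : Fin (n + 1) => S).sum_comp, Fintype.sum_prod_type,
    intervalIntegral.integral_finsetSum]
  · refine Finset.sum_congr rfl fun y _ => ?_
    rw [intervalIntegral.integral_finsetSum]
    · refine Finset.sum_congr rfl fun xs _ => ?_
      have h1 : (Fin.consEquiv fun _ : Fin (n + 1) => S) (y, xs) = Fin.cons y xs := rfl
      rw [h1, holdIntegral, ← intervalIntegral.integral_const_mul]
      congr 1
      funext t
      simp only [Fin.cons_zero, Fin.tail_cons]
      have : (Fin.cons x (Fin.cons y xs : Fin (n + 1) → S) : Fin (n + 2) → S) (Fin.last (n + 1)) =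
          (Fin.cons y xs : Fin (n + 1) → S) (Fin.last n) := by
        rw [← Fin.succ_last, Fin.cons_succ]
      rw [this]
      ring
    · intro xs _
      exact Continuous.intervalIntegrable (Continuous.mul (by fun_prop)
        (continuous_const.mul (continuous_holdIntegral _ _ _ _))) _ _
  · intro y _
    refine Continuous.intervalIntegrable (continuous_finsetSum _ fun xs _ =>
      Continuous.mul (by fun_prop)
        (continuous_const.mul (continuous_holdIntegral _ _ _ _))) _ _

/-- Paths weighted by a multiplicative functional. -/
theorem hasSum_pathSum_jumpProd {lam : S → ℝ} (hlam : ∀ x, 0 ≤ lam x) (k : S → S → ℝ)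
    (χ : S → ℝ) {E : ℝ → S → ℝ} (hE0 : ∀ x, E 0 x = χ x)
    (hE : ∀ t x, HasDerivAt (fun t => E t x) (∑ y, k x y * E t y - lam x * E t x) t)
    {a b : ℝ} (hab : a ≤ b) (x : S) :
    HasSum (fun n => pathSum lam b (fun _ xs => jumpProd k xs) χ n a x) (E (b - a) x) := by
  refine hasSum_of_duhamel hlam k χ b (fun a x => ?_) (fun n a x => ?_) hE0 hE hab x
  · simp [pathSum_zero, jumpProd]
  · rw [pathSum_succ]
    congr 1
    funext t
    congr 1
    refine Finset.sum_congr rfl fun y _ => ?_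
    simp only [pathSum, Finset.mul_sum]
    refine Finset.sum_congr rfl fun xs _ => ?_
    rw [jumpProd_cons, Fin.cons_zero]
    ring

/-- Paths weighted by an additive functional times a multiplicative functional. -/
theorem hasSum_pathSum_jumpSum {lam : S → ℝ} (hlam : ∀ x, 0 ≤ lam x) (k ψ : S → S → ℝ)
    (χ : S → ℝ) {E E' : ℝ → S → ℝ} (hE0 : ∀ x, E 0 x = χ x) (hE0' : ∀ x, E' 0 x = 0)
    (hE : ∀ t x, HasDerivAt (fun t => E t x) (∑ y, k x y * E t y - lam x * E t x) t)
    (hE' : ∀ t x, HasDerivAt (fun t => E' t x)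
      (∑ y, k x y * ψ x y * E t y + ∑ y, k x y * E' t y - lam x * E' t x) t)
    {a b : ℝ} (hab : a ≤ b) (x : S) :
    HasSum (fun n => pathSum lam b (fun _ xs => jumpSum ψ xs * jumpProd k xs) χ n a x)
      (E' (b - a) x) := by
  -- An additive functional is not closed under the first-jump recursion: it splits off ψ_xy times
  -- the plain weight. On two copies of S the pair of plain and additive sums satisfies one
  -- block-triangular linear recursion.
  have := hasSum_of_duhamel (ι := S ⊕ S) (lam := Sum.elim lam lam) (by simpa using hlam)
    (fun i j => Sum.elim (fun x => Sum.elim (k x) 0 j)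
      (fun x => Sum.elim (fun y => k x y * ψ x y) (k x) j) i) (Sum.elim χ 0) b
    (A := fun n a => Sum.elim (pathSum lam b (fun _ xs => jumpProd k xs) χ n a)
      (pathSum lam b (fun _ xs => jumpSum ψ xs * jumpProd k xs) χ n a))
    (E := fun t => Sum.elim (E t) (E' t)) ?_ ?_ ?_ ?_ hab (Sum.inr x)
  · simpa using this
  · rintro a (x | x)
    · simp [pathSum_zero, jumpProd]
    · simp [pathSum_zero, jumpSum]
  · rintro n a (x | x)
    · simp only [Sum.elim_inl, Fintype.sum_sum_type, Sum.elim_inr, Pi.zero_apply, zero_mul,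
        Finset.sum_const_zero, add_zero]
      rw [pathSum_succ]
      congr 1
      funext t
      congr 1
      refine Finset.sum_congr rfl fun y _ => ?_
      simp only [pathSum, Finset.mul_sum]
      refine Finset.sum_congr rfl fun xs _ => ?_
      rw [jumpProd_cons, Fin.cons_zero]
      ring
    · simp only [Sum.elim_inl, Fintype.sum_sum_type, Sum.elim_inr]
      rw [pathSum_succ]
      congr 1
      funext t
      congr 1
      rw [← Finset.sum_add_distrib]
      refine Finset.sum_congr rfl fun y _ => ?_
      simp only [pathSum, Finset.mul_sum]
      rw [← Finset.sum_add_distrib]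
      refine Finset.sum_congr rfl fun xs _ => ?_
      rw [jumpProd_cons, jumpSum_cons, Fin.cons_zero]
      ring
  · rintro (x | x)
    · simpa using hE0 x
    · simpa using hE0' x
  · rintro t (x | x)
    · simpa using hE t x
    · simpa using hE' t x

end PathSums

/-! ### Convergence to stationarity and the Poisson equation -/

section Ergodic

variable {S : Type*} [Fintype S]

/-- The backward generator of the jump process with rates `k`. -/
def gen (k : S → S → ℝ) (f : S → ℝ) (x : S) : ℝ := ∑ y, k x y * (f y - f x)

/-- `ρ` solves the balance equations of the jump process with rates `k`. -/
def IsInvariant (k : S → S → ℝ) (ρ : S → ℝ) : Prop := ∀ x, ∑ y, ρ y * k y x = ρ x * ∑ y, k x y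

/-- Any state can be reached from any other one through jumps with positive rates. -/
def IsConnected (k : S → S → ℝ) : Prop := ∀ x y, Relation.ReflTransGen (fun u v => 0 < k u v) x y

lemma gen_eq (k : S → S → ℝ) (f : S → ℝ) (x : S) :
    gen k f x = ∑ y, k x y * f y - (∑ y, k x y) * f x := by
  simp [gen, mul_sub, Finset.sum_sub_distrib, Finset.sum_mul]

lemma gen_add (k : S → S → ℝ) (f g : S → ℝ) (x : S) :
    gen k (fun y => f y + g y) x = gen k f x + gen k g x := by
  simp only [gen, ← Finset.sum_add_distrib]
  exact Finset.sum_congr rfl fun y _ => by ring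

lemma gen_sub (k : S → S → ℝ) (f g : S → ℝ) (x : S) :
    gen k (fun y => f y - g y) x = gen k f x - gen k g x := by
  simp only [gen, ← Finset.sum_sub_distrib]
  exact Finset.sum_congr rfl fun y _ => by ring

lemma gen_const_mul (k : S → S → ℝ) (a : ℝ) (f : S → ℝ) (x : S) :
    gen k (fun y => a * f y) x = a * gen k f x := by
  simp only [gen, Finset.mul_sum]
  exact Finset.sum_congr rfl fun y _ => by ring

variable {k : S → S → ℝ} {ρ : S → ℝ}

lemma IsInvariant.sum_mul_gen (h : IsInvariant k ρ) (f : S → ℝ) : ∑ x, ρ x * gen k f x = 0 := by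
  simp only [gen_eq, mul_sub, Finset.sum_sub_distrib, Finset.mul_sum]
  rw [Finset.sum_comm, sub_eq_zero]
  refine Finset.sum_congr rfl fun x _ => ?_
  have := congrArg (· * f x) (h x)
  simp only [Finset.sum_mul] at this
  calc _ = ∑ y, ρ y * k y x * f x := Finset.sum_congr rfl fun y _ => by ring
    _ = _ := by rw [this, Finset.mul_sum, Finset.sum_mul, Finset.sum_mul, Finset.mul_sum]
                exact Finset.sum_congr rfl fun y _ => by ring

/-- The inner sum of k_xy (f_x - f_y)² is gen(f²) - 2 f gen f, and gen(f²) has ρ-mean zero. No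
reversibility is needed. -/
lemma IsInvariant.energy_eq (h : IsInvariant k ρ) (f : S → ℝ) :
    ∑ x, ∑ y, ρ x * k x y * (f x - f y) ^ 2 = -∑ x, ρ x * (2 * f x * gen k f x) := by
  have h1 := h.sum_mul_gen fun x => f x ^ 2
  have h2 : ∑ x, ∑ y, ρ x * k x y * (f x - f y) ^ 2 =
      ∑ x, ρ x * gen k (fun x => f x ^ 2) x - ∑ x, ρ x * (2 * f x * gen k f x) := by
    rw [← Finset.sum_sub_distrib]
    refine Finset.sum_congr rfl fun x _ => ?_
    simp only [gen, Finset.mul_sum, ← Finset.sum_sub_distrib]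
    exact Finset.sum_congr rfl fun y _ => by ring
  rw [h2, h1, zero_sub]

/-- Telescope along a chain from x to y with (a + b)² ≤ 2a² + 2b²; each bond is one term of the
energy. -/
lemma exists_sq_sub_le_energy (hk : ∀ x y, 0 ≤ k x y) (hρ : ∀ x, 0 < ρ x) {x y : S}
    (hxy : Relation.ReflTransGen (fun u v => 0 < k u v) x y) :
    ∃ C : ℝ, 0 ≤ C ∧ ∀ f : S → ℝ,
      (f x - f y) ^ 2 ≤ C * ∑ x, ∑ y, ρ x * k x y * (f x - f y) ^ 2 := by
  have hnn : ∀ (f : S → ℝ) x y, 0 ≤ ρ x * k x y * (f x - f y) ^ 2 := fun f x y =>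
    mul_nonneg (mul_nonneg (hρ x).le (hk x y)) (sq_nonneg _)
  induction hxy with
  | refl => exact ⟨0, le_rfl, by simp⟩
  | @tail u v _ huv ih =>
    obtain ⟨C, hC, hf⟩ := ih
    have hp : 0 < ρ u * k u v := mul_pos (hρ u) huv
    refine ⟨2 * C + 2 * (ρ u * k u v)⁻¹, by positivity, fun f => ?_⟩
    set D := ∑ x, ∑ y, ρ x * k x y * (f x - f y) ^ 2
    have h1 : ρ u * k u v * (f u - f v) ^ 2 ≤ D :=
      (Finset.single_le_sum (f := fun y => ρ u * k u y * (f u - f y) ^ 2)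
        (fun y _ => hnn f u y) (Finset.mem_univ v)).trans
      (Finset.single_le_sum (f := fun x => ∑ y, ρ x * k x y * (f x - f y) ^ 2)
        (fun x _ => Finset.sum_nonneg fun y _ => hnn f x y) (Finset.mem_univ u))
    have h2 : (f u - f v) ^ 2 ≤ (ρ u * k u v)⁻¹ * D := by
      rwa [inv_mul_eq_div, le_div_iff₀ hp, mul_comm]
    have h3 := hf f
    nlinarith [sq_nonneg ((f x - f u) - (f u - f v))]

/-- The Poincaré inequality. -/
lemma exists_poincare (hk : ∀ x y, 0 ≤ k x y) (hc : IsConnected k) (hρ : ∀ x, 0 < ρ x)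
    (hρ1 : ∑ x, ρ x = 1) :
    ∃ C : ℝ, 0 < C ∧ ∀ f : S → ℝ, ∑ x, ρ x * f x = 0 →
      ∑ x, ρ x * f x ^ 2 ≤ C * ∑ x, ∑ y, ρ x * k x y * (f x - f y) ^ 2 := by
  choose C hC0 hC using fun x y => exists_sq_sub_le_energy hk hρ (hc x y)
  refine ⟨(∑ x, ∑ y, ρ x * ρ y * C x y) + 1, ?_, fun f hf => ?_⟩
  · have : 0 ≤ ∑ x, ∑ y, ρ x * ρ y * C x y := Finset.sum_nonneg fun x _ =>
      Finset.sum_nonneg fun y _ => mul_nonneg (mul_nonneg (hρ x).le (hρ y).le) (hC0 x y)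
    linarith
  set D := ∑ x, ∑ y, ρ x * k x y * (f x - f y) ^ 2 with hD
  have hD0 : 0 ≤ D := Finset.sum_nonneg fun x _ => Finset.sum_nonneg fun y _ =>
    mul_nonneg (mul_nonneg (hρ x).le (hk x y)) (sq_nonneg _)
  -- For a centred function the variance is half the double sum over independent pairs, so bounds on
  -- pairs suffice.
  have h1 : ∑ x, ∑ y, ρ x * ρ y * (f x - f y) ^ 2 = 2 * ∑ x, ρ x * f x ^ 2 := by
    have : ∀ x, ∑ y, ρ x * ρ y * (f x - f y) ^ 2 =
        ρ x * f x ^ 2 * ∑ y, ρ y - 2 * (ρ x * f x) * ∑ y, ρ y * f y +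
          ρ x * ∑ y, ρ y * f y ^ 2 := by
      intro x
      simp only [Finset.mul_sum, ← Finset.sum_sub_distrib, ← Finset.sum_add_distrib]
      exact Finset.sum_congr rfl fun y _ => by ring
    simp only [this, hρ1, hf, mul_zero, sub_zero, mul_one, Finset.sum_add_distrib,
      ← Finset.sum_mul, one_mul]
    ring
  have h2 : ∑ x, ∑ y, ρ x * ρ y * (f x - f y) ^ 2 ≤ (∑ x, ∑ y, ρ x * ρ y * C x y) * D := by
    simp only [Finset.sum_mul]
    refine Finset.sum_le_sum fun x _ => Finset.sum_le_sum fun y _ => ?_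
    rw [mul_assoc (ρ x * ρ y)]
    exact mul_le_mul_of_nonneg_left (hC x y f) (mul_nonneg (hρ x).le (hρ y).le)
  have h3 : 0 ≤ ∑ x, ρ x * f x ^ 2 := Finset.sum_nonneg fun x _ =>
    mul_nonneg (hρ x).le (sq_nonneg _)
  linarith

lemma IsInvariant.sum_mul_eq (h : IsInvariant k ρ) {E : ℝ → S → ℝ}
    (hE : ∀ t x, HasDerivAt (fun t => E t x) (gen k (E t) x) t) (t : ℝ) :
    ∑ x, ρ x * E t x = ∑ x, ρ x * E 0 x := by
  have hd : ∀ t, HasDerivAt (fun t => ∑ x, ρ x * E t x) 0 t := by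
    intro t
    have := HasDerivAt.fun_sum (u := Finset.univ) fun x _ => (hE t x).const_mul (ρ x)
    rwa [h.sum_mul_gen] at this
  exact is_const_of_deriv_eq_zero (fun t => (hd t).differentiableAt) (fun t => (hd t).deriv) t 0

/-- Convergence to the stationary distribution. -/
theorem tendsto_of_gen (hk : ∀ x y, 0 ≤ k x y) (hc : IsConnected k) (hρ : ∀ x, 0 < ρ x)
    (hρ1 : ∑ x, ρ x = 1) (h : IsInvariant k ρ) {E : ℝ → S → ℝ}
    (hE : ∀ t x, HasDerivAt (fun t => E t x) (gen k (E t) x) t) (x : S) :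
    Tendsto (fun t => E t x) atTop (𝓝 (∑ y, ρ y * E 0 y)) := by
  obtain ⟨C, hC0, hC⟩ := exists_poincare hk hc hρ hρ1
  set m := ∑ y, ρ y * E 0 y with hm
  set φ : ℝ → ℝ := fun t => ∑ x, ρ x * (E t x - m) ^ 2 with hφ
  have hd : ∀ t, HasDerivAt φ (∑ x, ρ x * (2 * (E t x - m) * gen k (E t) x)) t := by
    intro t
    have := HasDerivAt.fun_sum (u := Finset.univ) fun x _ =>
      ((((hE t x).sub_const m).pow 2).const_mul (ρ x))
    convert! this using 1
    refine Finset.sum_congr rfl fun x _ => ?_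
    simp
  have hle : ∀ t, ∑ x, ρ x * (2 * (E t x - m) * gen k (E t) x) ≤ -(φ t / C) := by
    intro t
    have h0 : ∑ x, ρ x * (E t x - m) = 0 := by
      simp only [mul_sub, Finset.sum_sub_distrib, h.sum_mul_eq hE t, ← Finset.sum_mul, hρ1]
      simp [hm]
    have h1 := hC _ h0
    rw [h.energy_eq] at h1
    have h2 : ∀ x, gen k (fun x => E t x - m) x = gen k (E t) x := by
      intro x; simp [gen]
    simp only [h2] at h1
    rw [le_neg, div_le_iff₀' hC0]
    exact h1
  -- Gronwall: the variance φ satisfies φ' ≤ -φ/C by the energy identity and the Poincaré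
  -- inequality, and hence decays exponentially.
  have hanti : Antitone fun t => Real.exp (t / C) * φ t := by
    have hd2 : ∀ t, HasDerivAt (fun t => Real.exp (t / C) * φ t)
        (Real.exp (t / C) * (1 / C) * φ t +
          Real.exp (t / C) * ∑ x, ρ x * (2 * (E t x - m) * gen k (E t) x)) t := fun t =>
      (((hasDerivAt_id t).div_const C).exp).mul (hd t)
    refine antitone_of_deriv_nonpos (fun t => (hd2 t).differentiableAt) fun t => ?_
    rw [(hd2 t).deriv]
    have := mul_le_mul_of_nonneg_left (hle t) (Real.exp_pos (t / C)).le
    calc _ ≤ Real.exp (t / C) * (1 / C) * φ t + Real.exp (t / C) * (-(φ t / C)) := by gcongr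
      _ = 0 := by ring
  have hφle : ∀ t, 0 ≤ t → φ t ≤ Real.exp (-(t / C)) * φ 0 := by
    intro t ht
    have := hanti ht
    simp only [zero_div, Real.exp_zero, one_mul] at this
    rw [Real.exp_neg, inv_mul_eq_div, le_div_iff₀ (Real.exp_pos _), mul_comm]
    exact this
  have hsq : Tendsto (fun t => (E t x - m) ^ 2) atTop (𝓝 0) := by
    have hlim : Tendsto (fun t => (ρ x)⁻¹ * (Real.exp (-(t / C)) * φ 0)) atTop (𝓝 0) := by
      have : Tendsto (fun t => Real.exp (-(t / C))) atTop (𝓝 0) :=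
        Real.tendsto_exp_neg_atTop_nhds_zero.comp (tendsto_id.atTop_div_const hC0)
      simpa using (this.mul_const (φ 0)).const_mul (ρ x)⁻¹
    refine squeeze_zero' (Eventually.of_forall fun t => sq_nonneg _) ?_ hlim
    filter_upwards [eventually_ge_atTop 0] with t ht
    rw [inv_mul_eq_div, le_div_iff₀ (hρ x), mul_comm]
    exact (Finset.single_le_sum (f := fun x => ρ x * (E t x - m) ^ 2)
      (fun x _ => mul_nonneg (hρ x).le (sq_nonneg _)) (Finset.mem_univ x)).trans (hφle t ht)
  have habs : Tendsto (fun t => |E t x - m|) atTop (𝓝 0) := by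
    have := (Real.continuous_sqrt.tendsto 0).comp hsq
    simpa [Function.comp_def, Real.sqrt_sq_eq_abs] using this
  have := (tendsto_zero_iff_abs_tendsto_zero _).2 habs
  simpa using this.add_const m

lemma exists_flow {ι : Type*} [Fintype ι] (B : ι → ι → ℝ) (f : ι → ℝ) :
    ∃ E : ℝ → ι → ℝ, E 0 = f ∧
      ∀ t i, HasDerivAt (fun t => E t i) (∑ j, B i j * E t j) t := by
  classical
  let T : (ι → ℝ) →L[ℝ] (ι → ℝ) := LinearMap.toContinuousLinearMap (Matrix.toLin' (Matrix.of B))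
  refine ⟨fun t => NormedSpace.exp (t • T) f, by simp, fun t i => ?_⟩
  have h1 := hasDerivAt_exp_smul_const' (𝕂 := ℝ) T t
  have h2 : HasDerivAt (fun t : ℝ => NormedSpace.exp (t • T) f)
      ((T * NormedSpace.exp (t • T)) f) t := by
    simpa using h1.clm_apply (hasDerivAt_const t f)
  have h3 := (hasDerivAt_pi.1 h2) i
  convert! h3 using 1

lemma exists_gen_flow (k : S → S → ℝ) (f : S → ℝ) :
    ∃ E : ℝ → S → ℝ, E 0 = f ∧ ∀ t x, HasDerivAt (fun t => E t x) (gen k (E t) x) t := by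
  classical
  obtain ⟨E, h0, hE⟩ := exists_flow
    (fun x y => k x y - if x = y then ∑ z, k x z else 0) f
  refine ⟨E, h0, fun t x => ?_⟩
  convert! hE t x using 1
  simp [gen_eq, sub_mul, Finset.sum_sub_distrib]

/-- Uniqueness of the stationary distribution. -/
lemma IsInvariant.unique (hk : ∀ x y, 0 ≤ k x y) (hc : IsConnected k) (hρ : ∀ x, 0 < ρ x)
    (hρ1 : ∑ x, ρ x = 1) (h : IsInvariant k ρ) {ρ' : S → ℝ} (h1 : ∑ x, ρ' x = 1)
    (h' : IsInvariant k ρ') : ρ' = ρ := by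
  classical
  funext x
  obtain ⟨E, h0, hE⟩ := exists_gen_flow k (Pi.single x 1)
  -- Evolve the indicator of x. Its ρ'-mean is conserved and equals ρ'_x, while the function
  -- converges to the constant ρ_x. Positivity of ρ' plays no role.
  have hl : Tendsto (fun t => ∑ y, ρ' y * E t y) atTop (𝓝 (∑ y, ρ' y * ∑ z, ρ z * E 0 z)) :=
    tendsto_finsetSum _ fun y _ => (tendsto_of_gen hk hc hρ hρ1 h hE y).const_mul (ρ' y)
  simp only [h'.sum_mul_eq hE, ← Finset.sum_mul, h1, one_mul] at hl
  have := tendsto_nhds_unique hl tendsto_const_nhds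
  simpa [h0, Pi.single_apply] using this.symm

/-- Solvability of the Poisson equation. -/
lemma exists_gen_eq (hk : ∀ x y, 0 ≤ k x y) (hc : IsConnected k) (hρ : ∀ x, 0 < ρ x)
    (hρ1 : ∑ x, ρ x = 1) (h : IsInvariant k ρ) {g : S → ℝ} (hg : ∑ x, ρ x * g x = 0) :
    ∃ V : S → ℝ, ∑ x, ρ x * V x = 0 ∧ ∀ x, gen k V x = g x := by
  -- Subtracting the mean removes the constants from the kernel of the generator. By the Poincaré
  -- inequality T is injective, hence surjective, and for a centred right-hand side the correction
  -- vanishes.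
  let T : (S → ℝ) →ₗ[ℝ] (S → ℝ) :=
    { toFun := fun f x => gen k f x - ∑ y, ρ y * f y
      map_add' := fun f g => by
        funext x
        have := gen_add k f g x
        simp only [Pi.add_apply, mul_add, Finset.sum_add_distrib]
        rw [show gen k (f + g) x = _ from this]
        ring
      map_smul' := fun a f => by
        funext x
        have := gen_const_mul k a f x
        simp only [Pi.smul_apply, smul_eq_mul, RingHom.id_apply, mul_sub, Finset.mul_sum]
        rw [show gen k (a • f) x = _ from this]
        congr 1
        exact Finset.sum_congr rfl fun y _ => by ring }
  have hTρ : ∀ f, ∑ x, ρ x * T f x = -∑ y, ρ y * f y := fun f => by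
    have : ∀ x, T f x = gen k f x - ∑ y, ρ y * f y := fun x => rfl
    simp only [this, mul_sub, Finset.sum_sub_distrib, h.sum_mul_gen, ← Finset.sum_mul, hρ1]
    ring
  have hinj : Function.Injective T := by
    rw [← LinearMap.ker_eq_bot, LinearMap.ker_eq_bot']
    intro f hf
    have h0 : ∑ y, ρ y * f y = 0 := by
      have := hTρ f
      simp only [hf, Pi.zero_apply, mul_zero, Finset.sum_const_zero] at this
      linarith
    have h1 : ∀ x, gen k f x = 0 := fun x => by
      have : gen k f x - ∑ y, ρ y * f y = 0 := congrFun hf x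
      rwa [h0, sub_zero] at this
    obtain ⟨C, _, hC⟩ := exists_poincare hk hc hρ hρ1
    have h2 := hC f h0
    rw [h.energy_eq] at h2
    simp only [h1, mul_zero, Finset.sum_const_zero, neg_zero] at h2
    have hnn : ∀ x ∈ Finset.univ, 0 ≤ ρ x * f x ^ 2 := fun x _ =>
      mul_nonneg (hρ x).le (sq_nonneg _)
    have h3 := (Finset.sum_eq_zero_iff_of_nonneg hnn).1
      (le_antisymm h2 (Finset.sum_nonneg hnn))
    funext x
    have := h3 x (Finset.mem_univ x)
    simpa [(hρ x).ne'] using this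
  obtain ⟨V, hV⟩ := LinearMap.injective_iff_surjective.1 hinj g
  have h0 : ∑ y, ρ y * V y = 0 := by
    have := hTρ V
    rw [hV, hg] at this
    linarith
  refine ⟨V, h0, fun x => ?_⟩
  have : gen k V x - ∑ y, ρ y * V y = g x := congrFun hV x
  rwa [h0, sub_zero] at this

end Ergodic

/-! ### Invariant vectors and Perron eigenvectors -/

section Perron

variable {S : Type*} [Fintype S]

/-- The generator annihilates constants, so it has a nonzero left null vector v. The triangle
inequality gives |v_x| Σ_y k_xy ≤ Σ_y |v_y| k_yx; both sides have the same sum over x, so equality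
holds everywhere and |v| is invariant. A zero of |v| would propagate backwards along the chains to
all states. -/
lemma exists_invariant [Nonempty S] {k : S → S → ℝ} (hk : ∀ x y, 0 ≤ k x y)
    (hc : IsConnected k) :
    ∃ ρ : S → ℝ, (∀ x, 0 < ρ x) ∧ ∑ x, ρ x = 1 ∧ IsInvariant k ρ := by
  classical
  let Q : Matrix S S ℝ := Matrix.of fun x y => k x y - if x = y then ∑ z, k x z else 0
  have hdet : Q.det = 0 := by
    refine Matrix.exists_mulVec_eq_zero_iff.1 ⟨1, one_ne_zero, ?_⟩
    funext x
    simp [Q, Matrix.mulVec, dotProduct, Finset.sum_sub_distrib]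
  obtain ⟨v, hv0, hv⟩ := Matrix.exists_vecMul_eq_zero_iff.2 hdet
  have hvinv : IsInvariant k v := by
    intro x
    have := congrFun hv x
    simp only [Matrix.vecMul, dotProduct, Q, Matrix.of_apply, mul_sub, mul_ite, mul_zero,
      Finset.sum_sub_distrib, Finset.sum_ite_eq', Finset.mem_univ, if_true,
      Pi.zero_apply] at this
    linarith
  have hle : ∀ x ∈ Finset.univ, |v x| * ∑ y, k x y ≤ ∑ y, |v y| * k y x := by
    intro x _
    calc |v x| * ∑ y, k x y = |v x * ∑ y, k x y| := by
          rw [abs_mul, abs_of_nonneg (Finset.sum_nonneg fun y _ => hk x y)]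
      _ = |∑ y, v y * k y x| := by rw [hvinv x]
      _ ≤ ∑ y, |v y * k y x| := Finset.abs_sum_le_sum_abs _ _
      _ = _ := Finset.sum_congr rfl fun y _ => by rw [abs_mul, abs_of_nonneg (hk y x)]
  have hsum : ∑ x, |v x| * ∑ y, k x y = ∑ x, ∑ y, |v y| * k y x := by
    rw [Finset.sum_comm]
    exact Finset.sum_congr rfl fun x _ => Finset.mul_sum _ _ _
  have heq := (Finset.sum_eq_sum_iff_of_le hle).1 hsum
  have hw : IsInvariant k fun x => |v x| := fun x => (heq x (Finset.mem_univ x)).symm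
  have hpos : ∀ x, 0 < |v x| := by
    by_contra! hcon
    obtain ⟨x, hx⟩ := hcon
    have hx0 : |v x| = 0 := le_antisymm hx (abs_nonneg _)
    refine hv0 (funext fun z => ?_)
    have : ∀ z, Relation.ReflTransGen (fun u v => 0 < k u v) z x → |v z| = 0 := by
      intro z hz
      induction hz using Relation.ReflTransGen.head_induction_on with
      | refl => exact hx0
      | @head u w huw _ ih =>
        have h1 := hw w
        simp only [ih, zero_mul] at h1
        have h2 := (Finset.sum_eq_zero_iff_of_nonneg fun y _ =>
          mul_nonneg (abs_nonneg (v y)) (hk y w)).1 h1 u (Finset.mem_univ u)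
        exact (mul_eq_zero.1 h2).resolve_right huw.ne'
    exact abs_eq_zero.1 (this z (hc z x))
  have hZ : 0 < ∑ x, |v x| := Finset.sum_pos (fun x _ => hpos x) Finset.univ_nonempty
  refine ⟨fun x => |v x| / ∑ x, |v x|, fun x => div_pos (hpos x) hZ, ?_, fun x => ?_⟩
  · rw [← Finset.sum_div, div_self hZ.ne']
  · have := hw x
    calc _ = (∑ y, |v y| * k y x) / ∑ x, |v x| := by
          rw [Finset.sum_div]; exact Finset.sum_congr rfl fun y _ => by ring
      _ = _ := by rw [this]; ring

/-- The Perron eigenvector of a matrix which satisfies the detailed balance conditions. -/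
theorem exists_perron [Nonempty S] {M : S → S → ℝ} {π : S → ℝ} (hπ : ∀ x, 0 < π x)
    (hM : ∀ x y, x ≠ y → 0 ≤ M x y)
    (hc : ∀ x y, Relation.ReflTransGen (fun u v => u ≠ v ∧ 0 < M u v) x y)
    (hsymm : ∀ x y, π x * M x y = π y * M y x) :
    ∃ (l : S → ℝ) (μ : ℝ), (∀ x, 0 < l x) ∧ ∀ x, ∑ y, M x y * l y = μ * l x := by
  classical
  -- Rayleigh quotient for the inner product weighted by π, in which M is self-adjoint. A maximiser
  -- may be replaced by its absolute value: off the diagonal M is nonnegative, and the diagonal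
  -- terms do not change.
  let q : (S → ℝ) → ℝ := fun f => ∑ x, ∑ y, π x * M x y * f x * f y
  let N : (S → ℝ) → ℝ := fun f => ∑ x, π x * f x ^ 2
  have hqc : Continuous q := by fun_prop
  have hNc : Continuous N := by fun_prop
  have hsph : IsCompact {f | N f = 1} := by
    refine (isCompact_univ_pi fun x => isCompact_Icc (a := -((π x)⁻¹ + 1))
      (b := (π x)⁻¹ + 1)).of_isClosed_subset (isClosed_eq hNc continuous_const) ?_
    intro f hf x _
    have h1 : π x * f x ^ 2 ≤ 1 := by
      rw [← (hf : N f = 1)]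
      exact Finset.single_le_sum (f := fun x => π x * f x ^ 2)
        (fun x _ => mul_nonneg (hπ x).le (sq_nonneg _)) (Finset.mem_univ x)
    have h2 : f x ^ 2 ≤ (π x)⁻¹ := by
      rwa [← one_div, le_div_iff₀ (hπ x), mul_comm]
    constructor <;> nlinarith [sq_nonneg (f x - 1), sq_nonneg (f x + 1)]
  have hne : {f | N f = 1}.Nonempty := by
    obtain ⟨x₀⟩ := ‹Nonempty S›
    refine ⟨Pi.single x₀ (Real.sqrt (π x₀)⁻¹), ?_⟩
    have : ∀ x, π x * (Pi.single x₀ (Real.sqrt (π x₀)⁻¹) : S → ℝ) x ^ 2 =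
        if x = x₀ then 1 else 0 := by
      intro x
      split_ifs with h
      · subst h
        rw [Pi.single_eq_same, Real.sq_sqrt (inv_nonneg.2 (hπ x).le), mul_inv_cancel₀ (hπ x).ne']
      · simp [h]
    show ∑ x, π x * (Pi.single x₀ (Real.sqrt (π x₀)⁻¹) : S → ℝ) x ^ 2 = 1
    simp only [this, Finset.sum_ite_eq', Finset.mem_univ, if_true]
  obtain ⟨v, hv1, hvmax⟩ := hsph.exists_isMaxOn hne hqc.continuousOn
  have hv1 : N v = 1 := hv1
  set μ := q v with hμ
  have hNnn : ∀ f, 0 ≤ N f := fun f => Finset.sum_nonneg fun x _ =>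
    mul_nonneg (hπ x).le (sq_nonneg _)
  have hle : ∀ f, q f ≤ μ * N f := by
    intro f
    rcases (hNnn f).eq_or_lt with h0 | hpos
    · have hz : ∀ x, f x = 0 := fun x => by
        have := (Finset.sum_eq_zero_iff_of_nonneg fun x _ =>
          mul_nonneg (hπ x).le (sq_nonneg (f x))).1 h0.symm x (Finset.mem_univ x)
        simpa [(hπ x).ne'] using this
      simp [q, N, hz]
    · have hs := Real.sqrt_pos.2 hpos
      have hs2 : Real.sqrt (N f) ^ 2 = N f := Real.sq_sqrt (hNnn f)
      have hmem : (fun x => f x / Real.sqrt (N f)) ∈ {f | N f = 1} := by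
        show ∑ x, π x * (f x / Real.sqrt (N f)) ^ 2 = 1
        simp only [div_pow, hs2, ← mul_div_assoc, ← Finset.sum_div]
        exact div_self hpos.ne'
      have h1 : q (fun x => f x / Real.sqrt (N f)) ≤ μ := hvmax hmem
      have h2 : q (fun x => f x / Real.sqrt (N f)) = q f / N f := by
        simp only [q, Finset.sum_div]
        refine Finset.sum_congr rfl fun x _ => Finset.sum_congr rfl fun y _ => ?_
        calc _ = π x * M x y * f x * f y / Real.sqrt (N f) ^ 2 := by ring
          _ = _ := by rw [hs2]
      rwa [h2, div_le_iff₀ hpos] at h1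
  set w : S → ℝ := fun x => |v x| with hw
  have hNw : N w = 1 := by rw [← hv1]; simp [N, hw]
  have hqw : q w = μ := by
    refine le_antisymm (by simpa [hNw] using hle w) ?_
    refine Finset.sum_le_sum fun x _ => Finset.sum_le_sum fun y _ => ?_
    by_cases hxy : x = y
    · subst hxy
      simp only [hw, mul_assoc, abs_mul_abs_self, le_refl]
    · have h1 := mul_nonneg (hπ x).le (hM x y hxy)
      rw [mul_assoc, mul_assoc (π x * M x y)]
      refine mul_le_mul_of_nonneg_left ?_ h1
      simp only [hw, ← abs_mul]
      exact le_abs_self _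
  have heig : ∀ x, ∑ y, M x y * w y = μ * w x := by
    intro x
    set a := π x * (μ * w x - ∑ y, M x y * w y) with ha
    set δ : S → ℝ := Pi.single x 1 with hδ
    have hN2 : ∀ t : ℝ, N (fun y => w y + t * δ y) =
        1 + 2 * t * π x * w x + t ^ 2 * π x := by
      intro t
      rw [← hNw]
      simp only [N, add_sq, mul_add, Finset.sum_add_distrib]
      congr 1
      · congr 1
        rw [Finset.sum_eq_single x (by intro y _ h; simp [hδ, h]) (by simp)]
        simp [hδ]; ring
      · rw [Finset.sum_eq_single x (by intro y _ h; simp [hδ, h]) (by simp)]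
        simp [hδ]; ring
    have hq2 : ∀ t : ℝ, q (fun y => w y + t * δ y) =
        μ + 2 * t * (π x * ∑ y, M x y * w y) + t ^ 2 * (π x * M x x) := by
      intro t
      rw [← hqw]
      have e : ∀ y z, π y * M y z * (w y + t * δ y) * (w z + t * δ z) =
          π y * M y z * w y * w z + t * (δ y * (π y * (M y z * w z))) +
          t * (δ z * (π z * (M z y * w y))) +
          t ^ 2 * (δ y * (δ z * (π y * M y z))) := by
        intro y z
        have := hsymm y z
        linear_combination (t * w y * δ z) * this
      simp only [q, e, Finset.sum_add_distrib, ← Finset.mul_sum]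
      simp [hδ, Pi.single_apply, Finset.mul_sum]
      ring_nf
      rw [Finset.sum_mul]
    -- First variation at the maximiser in the coordinate x. A quadratic polynomial in t without
    -- constant term that stays nonnegative has no linear term; t = -a/(|d|+1) is small enough for
    -- the linear term to win whatever the sign of d.
    have hquad : ∀ t : ℝ, 0 ≤ 2 * t * a + t ^ 2 * (π x * (μ - M x x)) := by
      intro t
      have := hle (fun y => w y + t * δ y)
      rw [hN2, hq2] at this
      rw [ha]
      linarith
    have ha0 : a = 0 := by
      set d := π x * (μ - M x x)
      have h1 := hquad (-a / (|d| + 1))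
      have hp : 0 < |d| + 1 := by positivity
      have h2 : 2 * (-a / (|d| + 1)) * a + (-a / (|d| + 1)) ^ 2 * d =
          a ^ 2 * (d - 2 * (|d| + 1)) / (|d| + 1) ^ 2 := by
        field_simp
        ring
      rw [h2] at h1
      have h3 : 0 ≤ a ^ 2 * (d - 2 * (|d| + 1)) := by
        by_contra! hneg
        exact absurd h1 (not_le.2 (div_neg_of_neg_of_pos hneg (by positivity)))
      have h4 : d - 2 * (|d| + 1) < 0 := by linarith [le_abs_self d, abs_nonneg d]
      have h5 : a ^ 2 ≤ 0 := by
        by_contra! hneg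
        nlinarith
      exact pow_eq_zero_iff two_ne_zero |>.1 (le_antisymm h5 (sq_nonneg _))
    have := (mul_eq_zero.1 (ha.symm.trans ha0)).resolve_left (hπ x).ne'
    linarith
  refine ⟨w, μ, fun x => ?_, heig⟩
  by_contra! hcon
  have hx0 : w x = 0 := le_antisymm hcon (abs_nonneg _)
  -- At a zero of w the eigenvalue equation is a vanishing sum of nonnegative terms, so the zero
  -- spreads to all neighbours, contradicting N w = 1.
  have hall : ∀ z, Relation.ReflTransGen (fun u v => u ≠ v ∧ 0 < M u v) x z → w z = 0 := by
    intro z hz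
    induction hz with
    | refl => exact hx0
    | @tail y z _ hyz ih =>
      have h1 := heig y
      rw [ih, mul_zero] at h1
      have h2 := (Finset.sum_eq_zero_iff_of_nonneg fun u _ => by
        by_cases hu : y = u
        · rw [← hu, ih, mul_zero]
        · exact mul_nonneg (hM y u hu) (abs_nonneg _)).1 h1 z (Finset.mem_univ z)
      exact (mul_eq_zero.1 h2).resolve_left hyz.2.ne'
  have : N w = 0 := by simp [N, hall _ (hc x _)]
  rw [hNw] at this
  exact one_ne_zero this

end Perron

/-! ### Long-time limits of the path integrals -/

section Limits

variable {S : Type*} [Fintype S] [DecidableEq S]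

lemma sum_offDiag (R : S → S → ℝ) (x : S) : ∑ y, offDiag R x y = escapeRate R x := by
  rw [escapeRate, ← Finset.add_sum_erase _ _ (Finset.mem_univ x)]
  simp only [offDiag, if_true, zero_add]
  exact Finset.sum_congr rfl fun y hy => if_neg (Finset.ne_of_mem_erase hy).symm

lemma gen_offDiag_eq (R : S → S → ℝ) (f : S → ℝ) (x : S) :
    gen (offDiag R) f x = ∑ y, offDiag R x y * f y - escapeRate R x * f x := by
  rw [gen_eq, sum_offDiag]

omit [Fintype S] in
lemma offDiag_nonneg {R : S → S → ℝ} (hR : ∀ x y, x ≠ y → 0 ≤ R x y) (x y : S) :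
    0 ≤ offDiag R x y := by
  unfold offDiag
  split_ifs with h
  · exact le_rfl
  · exact hR x y h

lemma escapeRate_nonneg {R : S → S → ℝ} (hR : ∀ x y, x ≠ y → 0 ≤ R x y) (x : S) :
    0 ≤ escapeRate R x := by
  rw [← sum_offDiag]
  exact Finset.sum_nonneg fun y _ => offDiag_nonneg hR x y

/-- The rates biased by half of the entropy production. -/
def tilted (R ψ : S → S → ℝ) (x y : S) : ℝ := offDiag R x y * Real.exp (-ψ x y / 2)

omit [Fintype S] in
-- The exponential of an additive functional is multiplicative, so it can be absorbed into the rates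
-- while the escape rates stay those of R.
lemma exp_jumpSum_mul_jumpProd (R ψ : S → S → ℝ) {n : ℕ} (xs : Fin (n + 1) → S) :
    Real.exp (-jumpSum ψ xs / 2) * jumpProd (offDiag R) xs = jumpProd (tilted R ψ) xs := by
  simp only [jumpProd, tilted, Finset.prod_mul_distrib, ← Real.exp_sum]
  rw [mul_comm]
  congr 2
  simp only [jumpSum, neg_div, Finset.sum_neg_distrib, Finset.sum_div]

lemma pathIntegral_exp_total {R ψ : S → S → ℝ} (hR : ∀ x y, x ≠ y → 0 ≤ R x y)
    (α χ : S → ℝ) {E : ℝ → S → ℝ} (hE0 : ∀ x, E 0 x = χ x)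
    (hE : ∀ t x, HasDerivAt (fun t => E t x)
      (∑ y, tilted R ψ x y * E t y - escapeRate R x * E t x) t)
    {a b : ℝ} (hab : a ≤ b) :
    pathIntegral a b (fun p => Real.exp (-p.total ψ / 2) * α p.first * χ p.last *
      p.weight R a b) = ∑ x, α x * E (b - a) x := by
  have h := pathIntegral_eq_tsum_pathSum R a b (fun _ xs => Real.exp (-jumpSum ψ xs / 2)) α χ
  simp only [exp_jumpSum_mul_jumpProd] at h
  refine h.trans (HasSum.tsum_eq ?_)
  exact hasSum_sum fun x _ =>
    (hasSum_pathSum_jumpProd (escapeRate_nonneg hR) _ χ hE0 hE hab x).mul_left (α x)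

lemma pathIntegral_total {R ψ : S → S → ℝ} (hR : ∀ x y, x ≠ y → 0 ≤ R x y)
    (α χ : S → ℝ) {E E' : ℝ → S → ℝ} (hE0 : ∀ x, E 0 x = χ x) (hE0' : ∀ x, E' 0 x = 0)
    (hE : ∀ t x, HasDerivAt (fun t => E t x) (gen (offDiag R) (E t) x) t)
    (hE' : ∀ t x, HasDerivAt (fun t => E' t x)
      (∑ y, offDiag R x y * ψ x y * E t y + gen (offDiag R) (E' t) x) t)
    {a b : ℝ} (hab : a ≤ b) :
    pathIntegral a b (fun p => p.total ψ * α p.first * χ p.last * p.weight R a b) =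
      ∑ x, α x * E' (b - a) x := by
  have h := pathIntegral_eq_tsum_pathSum R a b (fun _ xs => jumpSum ψ xs) α χ
  refine h.trans (HasSum.tsum_eq ?_)
  simp only [gen_offDiag_eq, ← add_sub_assoc] at hE hE'
  exact hasSum_sum fun x _ =>
    (hasSum_pathSum_jumpSum (escapeRate_nonneg hR) _ ψ χ hE0 hE0' hE hE' hab x).mul_left (α x)

lemma expFrom_eq (R : S → S → ℝ) (a b : ℝ) (x : S) (f : JumpPath S → ℝ) :
    expFrom R a b x f = pathIntegral a b fun p =>
      f p * (fun z => if z = x then 1 else 0) p.first * (fun _ => 1) p.last * p.weight R a b := by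
  simp [expFrom]

omit [DecidableEq S] in
/-- The asymptotic growth of the solutions of a linear equation with a positive Perron
eigenvector, by the Doob transformation. -/
lemma exists_tilted_flow {K : S → S → ℝ} {lam l r : S → ℝ} {μ : ℝ} [Nonempty S]
    (hK : ∀ x y, 0 ≤ K x y) (hc : IsConnected K) (hl : ∀ x, 0 < l x) (hr : ∀ x, 0 < r x)
    (hKl : ∀ x, ∑ y, K x y * l y = (μ + lam x) * l x)
    (hKr : ∀ x, ∑ y, r y * K y x = (μ + lam x) * r x) (χ : S → ℝ) :
    ∃ E : ℝ → S → ℝ, (∀ x, E 0 x = χ x) ∧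
      (∀ t x, HasDerivAt (fun t => E t x) (∑ y, K x y * E t y - lam x * E t x) t) ∧
      ∀ x, Tendsto (fun t => Real.exp (-(μ * t)) * E t x) atTop
        (𝓝 (l x * ((∑ y, r y * χ y) / ∑ y, l y * r y))) := by
  -- Doob transform: k has escape rates μ + λ and invariant distribution lr/Z, and E = exp(μt) l G
  -- turns its backward equation into the one for K. Convergence of G gives the claim.
  set k : S → S → ℝ := fun x y => K x y * l y / l x with hk
  set Z := ∑ y, l y * r y with hZ
  have hZ0 : 0 < Z := Finset.sum_pos (fun y _ => mul_pos (hl y) (hr y)) Finset.univ_nonempty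
  have hk0 : ∀ x y, 0 ≤ k x y := fun x y =>
    div_nonneg (mul_nonneg (hK x y) (hl y).le) (hl x).le
  have hkc : IsConnected k := fun x y =>
    Relation.ReflTransGen.mono (fun u v huv => div_pos (mul_pos huv (hl v)) (hl u)) x y (hc x y)
  have hksum : ∀ x, ∑ y, k x y = μ + lam x := by
    intro x
    rw [← Finset.sum_div, hKl, mul_div_cancel_right₀ _ (hl x).ne']
  have hinv : IsInvariant k fun x => l x * r x / Z := by
    intro x
    rw [hksum]
    calc _ = ∑ y, l x / Z * (r y * K y x) := Finset.sum_congr rfl fun y _ => by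
          have := (hl y).ne'
          simp only [hk]
          field_simp
      _ = _ := by rw [← Finset.mul_sum, hKr]; ring
  have h1 : ∑ x, l x * r x / Z = 1 := by rw [← Finset.sum_div, div_self hZ0.ne']
  obtain ⟨G, hG0, hG⟩ := exists_gen_flow k fun x => χ x / l x
  refine ⟨fun t x => Real.exp (μ * t) * (l x * G t x), fun x => ?_, fun t x => ?_, fun x => ?_⟩
  · simp only [mul_zero, Real.exp_zero, one_mul, hG0]
    exact mul_div_cancel₀ _ (hl x).ne'
  · have h2 := (((hasDerivAt_id t).const_mul μ).exp).mul ((hG t x).const_mul (l x))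
    convert! h2 using 1
    have h3 : l x * gen k (G t) x = ∑ y, K x y * (l y * G t y) - (μ + lam x) * (l x * G t x) := by
      rw [gen_eq, hksum, mul_sub, Finset.mul_sum]
      congr 1
      · refine Finset.sum_congr rfl fun y _ => ?_
        have := (hl x).ne'
        simp only [hk]
        field_simp
      · ring
    rw [h3, mul_sub, Finset.mul_sum]
    have h4 : ∑ y, K x y * (Real.exp (μ * t) * (l y * G t y)) =
        ∑ y, Real.exp (μ * t) * (K x y * (l y * G t y)) :=
      Finset.sum_congr rfl fun y _ => by ring
    rw [h4]
    simp only [id, mul_one]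
    ring
  · have h2 := (tendsto_of_gen hk0 hkc (fun x => div_pos (mul_pos (hl x) (hr x)) hZ0) h1 hinv hG
      x).const_mul (l x)
    have h3 : ∑ y, l y * r y / Z * G 0 y = (∑ y, r y * χ y) / Z := by
      rw [Finset.sum_div]
      refine Finset.sum_congr rfl fun y _ => ?_
      have := (hl y).ne'
      rw [hG0]
      field_simp
    rw [h3] at h2
    refine h2.congr fun t => ?_
    rw [← mul_assoc, ← Real.exp_add]
    simp

/-- The ratio which defines the free energy converges. -/
theorem tendsto_ratio [Nonempty S] {R ψ : S → S → ℝ} {ρ l r : S → ℝ} {μ : ℝ}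
    (hR : ∀ x y, x ≠ y → 0 ≤ R x y) (hc : IsConnected (offDiag R)) (hρ : ∀ x, 0 < ρ x)
    (hl : ∀ x, 0 < l x) (hr : ∀ x, 0 < r x)
    (hKl : ∀ x, ∑ y, tilted R ψ x y * l y = (μ + escapeRate R x) * l x)
    (hKr : ∀ x, ∑ y, r y * tilted R ψ y x = (μ + escapeRate R x) * r x) (x : S) :
    Tendsto (fun τ : ℝ => expFrom R (-τ) (-τ / 2) x (fun p => Real.exp (-p.total ψ / 2)) /
      unnormExpStTo R ρ (τ / 2) τ x (fun p => Real.exp (-p.total ψ / 2))) atTop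
      (𝓝 (l x * (∑ y, r y) / (r x * ∑ y, ρ y * l y))) := by
  have hK : ∀ x y, 0 ≤ tilted R ψ x y := fun x y =>
    mul_nonneg (offDiag_nonneg hR x y) (Real.exp_pos _).le
  have hKc : IsConnected (tilted R ψ) := fun x y =>
    Relation.ReflTransGen.mono (fun u v huv => mul_pos huv (Real.exp_pos _)) x y (hc x y)
  obtain ⟨E₁, h10, h1d, h1t⟩ := exists_tilted_flow hK hKc hl hr hKl hKr fun _ => 1
  obtain ⟨E₂, h20, h2d, h2t⟩ :=
    exists_tilted_flow hK hKc hl hr hKl hKr fun z => if z = x then 1 else 0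
  set Z := ∑ y, l y * r y
  have hZ0 : 0 < Z := Finset.sum_pos (fun y _ => mul_pos (hl y) (hr y)) Finset.univ_nonempty
  have hρl : 0 < ∑ y, ρ y * l y :=
    Finset.sum_pos (fun y _ => mul_pos (hρ y) (hl y)) Finset.univ_nonempty
  have hden : Tendsto (fun t => ∑ y, ρ y * (Real.exp (-(μ * t)) * E₂ t y)) atTop
      (𝓝 (∑ y, ρ y * (l y * ((∑ y, r y * if y = x then 1 else 0) / Z)))) :=
    tendsto_finsetSum _ fun y _ => (h2t y).const_mul (ρ y)
  have hden2 : ∑ y, ρ y * (l y * ((∑ y, r y * if y = x then 1 else 0) / Z)) =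
      (∑ y, ρ y * l y) * (r x / Z) := by
    simp [Finset.sum_mul, mul_assoc]
  rw [hden2] at hden
  have hq := (h1t x).div hden (mul_pos hρl (div_pos (hr x) hZ0)).ne'
  have hval : l x * ((∑ y, r y * 1) / Z) / ((∑ y, ρ y * l y) * (r x / Z)) =
      l x * (∑ y, r y) / (r x * ∑ y, ρ y * l y) := by
    have := (hr x).ne'
    simp only [mul_one]
    field_simp
  rw [hval] at hq
  have hhalf : Tendsto (fun τ : ℝ => τ / 2) atTop atTop :=
    tendsto_id.atTop_div_const (by norm_num)
  refine (hq.comp hhalf).congr' ?_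
  filter_upwards [eventually_ge_atTop 0] with τ hτ
  have e1 := pathIntegral_exp_total hR (fun z => if z = x then 1 else 0) (fun _ => 1) h10 h1d
    (a := -τ) (b := -τ / 2) (by linarith)
  have e2 := pathIntegral_exp_total hR ρ (fun z => if z = x then 1 else 0) h20 h2d
    (a := τ / 2) (b := τ) (by linarith)
  rw [expFrom_eq, e1, unnormExpStTo, e2]
  have a1 : -τ / 2 - -τ = τ / 2 := by ring
  have a2 : τ - τ / 2 = τ / 2 := by ring
  rw [a1, a2]
  -- Both time intervals have length τ/2, so the growth factors exp(μτ/2) cancel in the ratio.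
  have h5 : ∑ y, ρ y * (Real.exp (-(μ * (τ / 2))) * E₂ (τ / 2) y) =
      Real.exp (-(μ * (τ / 2))) * ∑ y, ρ y * E₂ (τ / 2) y := by
    rw [Finset.mul_sum]
    exact Finset.sum_congr rfl fun y _ => by ring
  simp only [Function.comp, Pi.div_apply, h5]
  rw [mul_div_mul_left _ _ (Real.exp_pos _).ne']
  simp

/-- The rates of the time-reversed process. -/
def revRate (k : S → S → ℝ) (ρ : S → ℝ) (x y : S) : ℝ := ρ y * k y x / ρ x

omit [DecidableEq S] in
lemma sum_revRate {k : S → S → ℝ} {ρ : S → ℝ} (hρ : ∀ x, 0 < ρ x) (h : IsInvariant k ρ) (x : S) :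
    ∑ y, revRate k ρ x y = ∑ y, k x y := by
  simp only [revRate]
  rw [← Finset.sum_div, h x, mul_div_cancel_left₀ _ (hρ x).ne']

omit [DecidableEq S] in
lemma isInvariant_revRate {k : S → S → ℝ} {ρ : S → ℝ} (hρ : ∀ x, 0 < ρ x)
    (h : IsInvariant k ρ) : IsInvariant (revRate k ρ) ρ := by
  intro x
  rw [sum_revRate hρ h, Finset.mul_sum]
  refine Finset.sum_congr rfl fun y _ => ?_
  have := (hρ y).ne'
  unfold revRate
  field_simp

omit [DecidableEq S] in
-- The reversed generator is the adjoint of the original one in ℓ²(ρ).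
lemma sum_mul_gen_revRate {k : S → S → ℝ} {ρ : S → ℝ} (hρ : ∀ x, 0 < ρ x)
    (h : IsInvariant k ρ) (f g : S → ℝ) :
    ∑ x, ρ x * (f x * gen (revRate k ρ) g x) = ∑ x, ρ x * (g x * gen k f x) := by
  simp only [gen_eq, sum_revRate hρ h, mul_sub, Finset.sum_sub_distrib, Finset.mul_sum]
  congr 1
  · rw [Finset.sum_comm]
    refine Finset.sum_congr rfl fun x _ => Finset.sum_congr rfl fun y _ => ?_
    have := (hρ y).ne'
    unfold revRate
    field_simp
  · exact Finset.sum_congr rfl fun x _ => by ring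

lemma exists_inhomogeneous_flow (k ψ : S → S → ℝ) (χ : S → ℝ) :
    ∃ E E' : ℝ → S → ℝ, E 0 = χ ∧ E' 0 = 0 ∧
      (∀ t x, HasDerivAt (fun t => E t x) (gen k (E t) x) t) ∧
      ∀ t x, HasDerivAt (fun t => E' t x) (∑ y, k x y * ψ x y * E t y + gen k (E' t) x) t := by
  obtain ⟨F, hF0, hF⟩ := exists_flow (ι := S ⊕ S)
    (fun i j => Sum.elim
      (fun x => Sum.elim (fun y => k x y - if x = y then ∑ z, k x z else 0) 0 j)
      (fun x => Sum.elim (fun y => k x y * ψ x y)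
        (fun y => k x y - if x = y then ∑ z, k x z else 0) j) i) (Sum.elim χ 0)
  refine ⟨fun t x => F t (Sum.inl x), fun t x => F t (Sum.inr x), ?_, ?_, fun t x => ?_,
    fun t x => ?_⟩
  · funext x; simp [hF0]
  · funext x; simp [hF0]
  · convert! hF t (Sum.inl x) using 1
    simp [gen_eq, sub_mul, Finset.sum_sub_distrib]
  · convert! hF t (Sum.inr x) using 1
    simp [gen_eq, sub_mul, Finset.sum_sub_distrib]

/-- The difference of the mean entropy productions converges. -/
theorem tendsto_expFrom_sub_expStTo [Nonempty S] {R ψ : S → S → ℝ} {ρ V U : S → ℝ} {m : ℝ}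
    (hR : ∀ x y, x ≠ y → 0 ≤ R x y) (hc : IsConnected (offDiag R)) (hρ : ∀ x, 0 < ρ x)
    (hρ1 : ∑ x, ρ x = 1) (hinv : IsInvariant (offDiag R) ρ)
    (hV0 : ∑ x, ρ x * V x = 0) (hU0 : ∑ x, ρ x * U x = 0)
    (hV : ∀ x, gen (offDiag R) V x = m - ∑ y, offDiag R x y * ψ x y)
    (hU : ∀ x, gen (revRate (offDiag R) ρ) U x =
      m - ∑ y, revRate (offDiag R) ρ x y * ψ y x) (x : S) :
    Tendsto (fun τ : ℝ => expFrom R (-τ) τ x (JumpPath.total ψ) -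
      expStTo R ρ (-τ) τ x (JumpPath.total ψ)) atTop (𝓝 (V x - U x)) := by
  have hk := offDiag_nonneg hR
  obtain ⟨v, hv0, hv⟩ := exists_gen_flow (offDiag R) V
  obtain ⟨E, E', hE0, hE0', hE, hE'⟩ :=
    exists_inhomogeneous_flow (offDiag R) ψ fun z => if z = x then 1 else 0
  have hvt := tendsto_of_gen hk hc hρ hρ1 hinv hv x
  have hEt : Tendsto (fun t => ∑ y, ρ y * U y * E t y) atTop
      (𝓝 (∑ y, ρ y * U y * ∑ z, ρ z * E 0 z)) :=
    tendsto_finsetSum _ fun y _ => (tendsto_of_gen hk hc hρ hρ1 hinv hE y).const_mul _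
  rw [hv0, hV0] at hvt
  rw [← Finset.sum_mul, hU0, zero_mul] at hEt
  -- With terminal weight 1, the inhomogeneous equation is solved by mt + V - v(t), where v is the
  -- flow started from V: the Poisson equation for V supplies the source, and v vanishes in the
  -- limit because V is centred.
  have hfrom : ∀ τ : ℝ, 0 ≤ τ → expFrom R (-τ) τ x (JumpPath.total ψ) =
      m * (2 * τ) + V x - v (2 * τ) x := by
    intro τ hτ
    have := pathIntegral_total hR (fun z => if z = x then 1 else 0) (fun _ => 1) (ψ := ψ)
      (E := fun _ _ => 1) (E' := fun t x => m * t + V x - v t x) (fun _ => rfl)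
      (fun y => by simp [hv0]) (fun t y => by simpa [gen] using hasDerivAt_const t (1 : ℝ))
      (fun t y => ?_) (a := -τ) (b := τ) (by linarith)
    · rw [expFrom_eq, this, sub_neg_eq_add, ← two_mul]
      simp
    · have h1 := (((hasDerivAt_id t).const_mul m).add_const (V y)).sub (hv t y)
      convert! h1 using 1
      have h2 : gen (offDiag R) (fun x => m * t + V x - v t x) y =
          gen (offDiag R) V y - gen (offDiag R) (v t) y := by
        rw [gen_sub, gen_add]
        simp [gen]
      rw [h2, hV]
      simp
      ring
  have hto : ∀ τ : ℝ, 0 ≤ τ → unnormExpStTo R ρ (-τ) τ x (JumpPath.total ψ) =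
      ρ x * (m * (2 * τ) + U x) - ∑ y, ρ y * U y * E (2 * τ) y := by
    intro τ hτ
    have h1 := pathIntegral_total hR ρ (fun z => if z = x then 1 else 0) (ψ := ψ)
      (congrFun hE0) (congrFun hE0') hE hE' (a := -τ) (b := τ) (by linarith)
    rw [unnormExpStTo, h1, sub_neg_eq_add, ← two_mul]
    -- A conserved quantity replaces an explicit solution. By adjointness, the production of Σ ρE'
    -- is compensated by the change of Σ ρUE, up to the growth mρ_x t.
    have hd : ∀ t, HasDerivAt (fun t => ∑ y, ρ y * E' t y +
        (∑ y, ρ y * U y * E t y - ρ x * (m * t))) 0 t := by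
      intro t
      have d1 := HasDerivAt.fun_sum (u := Finset.univ) fun y _ => (hE' t y).const_mul (ρ y)
      have d2 := HasDerivAt.fun_sum (u := Finset.univ) fun y _ =>
        (hE t y).const_mul (ρ y * U y)
      have d3 := ((hasDerivAt_id t).const_mul m).const_mul (ρ x)
      convert! d1.add (d2.sub d3) using 1
      have e1 : ∑ y, ρ y * (∑ z, offDiag R y z * ψ y z * E t z + gen (offDiag R) (E' t) y) =
          ∑ z, ρ z * (E t z * ∑ y, revRate (offDiag R) ρ z y * ψ y z) := by
        simp only [mul_add, Finset.sum_add_distrib, hinv.sum_mul_gen, add_zero, Finset.mul_sum]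
        rw [Finset.sum_comm]
        refine Finset.sum_congr rfl fun z _ => Finset.sum_congr rfl fun y _ => ?_
        have := (hρ z).ne'
        unfold revRate
        field_simp
      have e2 : ∑ y, ρ y * U y * gen (offDiag R) (E t) y =
          ∑ z, ρ z * (E t z * gen (revRate (offDiag R) ρ) U z) := by
        rw [sum_mul_gen_revRate hρ hinv]
        exact Finset.sum_congr rfl fun y _ => by ring
      rw [e1, e2]
      simp only [hU]
      have e3 : ∑ z, ρ z * E t z = ρ x := by
        rw [hinv.sum_mul_eq hE, hE0]
        simp
      rw [← add_sub_assoc, ← Finset.sum_add_distrib]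
      have e4 : ∀ z, ρ z * (E t z * ∑ y, revRate (offDiag R) ρ z y * ψ y z) +
          ρ z * (E t z * (m - ∑ y, revRate (offDiag R) ρ z y * ψ y z)) =
            m * (ρ z * E t z) := fun z => by ring
      simp only [e4, ← Finset.mul_sum, e3]
      ring
    have h2 := is_const_of_deriv_eq_zero (fun t => (hd t).differentiableAt)
      (fun t => (hd t).deriv) (2 * τ) 0
    simp only [hE0, hE0', Pi.zero_apply, mul_zero, Finset.sum_const_zero, zero_add, sub_zero,
      mul_ite, mul_one, Finset.sum_ite_eq', Finset.mem_univ, if_true] at h2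
    linarith
  have hlim : Tendsto (fun τ : ℝ => V x - v (2 * τ) x -
      (U x - (∑ y, ρ y * U y * E (2 * τ) y) / ρ x)) atTop (𝓝 (V x - 0 - (U x - 0 / ρ x))) := by
    have h2 : Tendsto (fun τ : ℝ => 2 * τ) atTop atTop :=
      tendsto_id.const_mul_atTop (by norm_num)
    exact ((hvt.comp h2).const_sub _).sub (((hEt.comp h2).div_const _).const_sub _)
  simp only [sub_zero, zero_div] at hlim
  refine hlim.congr' ?_
  filter_upwards [eventually_ge_atTop 0] with τ hτ
  rw [expStTo, hfrom τ hτ, hto τ hτ, sub_div, mul_div_cancel_left₀ _ (hρ x).ne']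
  ring

end Limits

/-! ### Bounds uniform in the rates -/

section Bounds

lemma abs_mul_le {a b A B : ℝ} (ha : |a| ≤ A) (hb : |b| ≤ B) : |a * b| ≤ A * B := by
  rw [abs_mul]
  exact mul_le_mul ha hb (abs_nonneg _) ((abs_nonneg _).trans ha)

lemma abs_add_le_of_le {a b A B : ℝ} (ha : |a| ≤ A) (hb : |b| ≤ B) : |a + b| ≤ A + B :=
  (abs_add_le a b).trans (add_le_add ha hb)

lemma abs_sub_le_of_le {a b A B : ℝ} (ha : |a| ≤ A) (hb : |b| ≤ B) : |a - b| ≤ A + B :=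
  (abs_sub a b).trans (add_le_add ha hb)

lemma abs_exp_sub_sum_le {z d : ℝ} (hz : |z| ≤ d) (n : ℕ) :
    |Real.exp z - ∑ m ∈ Finset.range n, z ^ m / m.factorial| ≤ Real.exp d * |z| ^ n := by
  have h := Complex.norm_exp_sub_sum_le_norm_mul_exp (z : ℂ) n
  have h2 : Complex.exp (z : ℂ) - ∑ m ∈ Finset.range n, (z : ℂ) ^ m / m.factorial =
      ((Real.exp z - ∑ m ∈ Finset.range n, z ^ m / m.factorial : ℝ) : ℂ) := by push_cast; rfl
  rw [h2, Complex.norm_real, Complex.norm_real, Real.norm_eq_abs, Real.norm_eq_abs] at h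
  refine h.trans ?_
  rw [mul_comm]
  gcongr

/-- For |y - 1| ≤ 1/2 this is Taylor's formula. Otherwise |y - 1|³ ≥ 1/8, so a crude bound on each
term is enough; this is the origin of the factor 8. -/
lemma exists_abs_log_sub_le (M : ℝ) (hM : 1 ≤ M) :
    ∃ C : ℝ, 0 ≤ C ∧ ∀ y : ℝ, M⁻¹ ≤ y → y ≤ M →
      |Real.log y - (y - 1) + (y - 1) ^ 2 / 2| ≤ C * |y - 1| ^ 3 := by
  have hM0 : 0 < M := by linarith
  refine ⟨2 + 8 * (M + M + M ^ 2 / 2), by positivity, fun y hy1 hy2 => ?_⟩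
  have hy0 : 0 < y := (inv_pos.2 hM0).trans_le hy1
  have h3 : 0 ≤ |y - 1| ^ 3 := by positivity
  rcases le_or_gt |y - 1| (1 / 2) with h | h
  · have h1 := Real.abs_log_sub_add_sum_range_le (x := 1 - y)
      (by rw [abs_sub_comm]; linarith) 2
    rw [abs_sub_comm 1 y, sub_sub_cancel] at h1
    simp only [Finset.sum_range_succ, Finset.sum_range_zero] at h1
    have h2 : |y - 1| ^ (2 + 1) / (1 - |y - 1|) ≤ 2 * |y - 1| ^ 3 := by
      rw [div_le_iff₀ (by linarith)]
      have h5 : 0 ≤ |y - 1| ^ 3 * (1 - 2 * |y - 1|) := mul_nonneg h3 (by linarith)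
      norm_num
      linarith
    have h4 : Real.log y - (y - 1) + (y - 1) ^ 2 / 2 =
        0 + (1 - y) ^ (0 + 1) / ((0 : ℕ) + 1) + (1 - y) ^ (1 + 1) / ((1 : ℕ) + 1) + Real.log y := by
      push_cast; ring
    rw [h4]
    refine (h1.trans h2).trans ?_
    have : 0 ≤ 8 * (M + M + M ^ 2 / 2) * |y - 1| ^ 3 := by positivity
    linarith
  · have hlog : |Real.log y| ≤ M := by
      rw [abs_le]
      constructor
      · have := Real.log_le_sub_one_of_pos (inv_pos.2 hy0)
        rw [Real.log_inv] at this
        have h5 : y⁻¹ ≤ M := inv_le_of_inv_le₀ hM0 hy1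
        linarith
      · linarith [Real.log_le_sub_one_of_pos hy0]
    have hy : |y - 1| ≤ M := by rw [abs_le]; constructor <;> linarith
    have h8 : 1 / 8 ≤ |y - 1| ^ 3 := by
      have := pow_le_pow_left₀ (by norm_num) h.le 3
      norm_num at this ⊢
      exact this
    have hsq : |(y - 1) ^ 2 / 2| ≤ M ^ 2 / 2 := by
      rw [abs_div, abs_pow, abs_two]
      gcongr
    refine (abs_add_le_of_le (abs_sub_le_of_le hlog hy) hsq).trans ?_
    have : 0 ≤ M + M + M ^ 2 / 2 := by positivity
    nlinarith

variable {S : Type*} [Fintype S]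

lemma abs_sum_mul_le {p g : S → ℝ} {Λ γ : ℝ} (hp : ∀ y, 0 ≤ p y) (hpΛ : ∑ y, p y ≤ Λ)
    (hγ : 0 ≤ γ) (hg : ∀ y, |g y| ≤ γ) : |∑ y, p y * g y| ≤ Λ * γ := by
  calc |∑ y, p y * g y| ≤ ∑ y, p y * γ := (Finset.abs_sum_le_sum_abs _ _).trans
        (Finset.sum_le_sum fun y _ => by
          rw [abs_mul, abs_of_nonneg (hp y)]
          exact mul_le_mul_of_nonneg_left (hg y) (hp y))
    _ = (∑ y, p y) * γ := by rw [Finset.sum_mul]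
    _ ≤ Λ * γ := mul_le_mul_of_nonneg_right hpΛ hγ

lemma abs_sum_mul_le_card {p g : S → ℝ} {η γ : ℝ} (hη : ∀ y, |p y| ≤ η)
    (hg : ∀ y, |g y| ≤ γ) : |∑ y, p y * g y| ≤ Fintype.card S * (η * γ) := by
  refine (Finset.abs_sum_le_sum_abs _ _).trans ?_
  refine (Finset.sum_le_sum fun y _ => abs_mul_le (hη y) (hg y)).trans ?_
  simp

/-- The rates `k` are comparable with `c`. -/
def Comparable (c : S → S → ℝ) (B : ℝ) (k : S → S → ℝ) : Prop :=
  ∀ x y, c x y / B ≤ k x y ∧ k x y ≤ B * c x y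

variable {c : S → S → ℝ}

omit [Fintype S] in
lemma Comparable.nonneg {B : ℝ} (hB : 0 < B) (hc0 : ∀ x y, 0 ≤ c x y) {k : S → S → ℝ}
    (h : Comparable c B k) (x y : S) : 0 ≤ k x y :=
  (div_nonneg (hc0 x y) hB.le).trans (h x y).1

lemma Comparable.sum_le {B : ℝ} (hB : 0 < B) (hc0 : ∀ x y, 0 ≤ c x y) {k : S → S → ℝ}
    (h : Comparable c B k) (x : S) : ∑ y, k x y ≤ B * ∑ x, ∑ y, c x y := by
  calc ∑ y, k x y ≤ ∑ y, B * c x y := Finset.sum_le_sum fun y _ => (h x y).2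
    _ = B * ∑ y, c x y := by rw [Finset.mul_sum]
    _ ≤ _ := mul_le_mul_of_nonneg_left (Finset.single_le_sum (f := fun x => ∑ y, c x y)
        (fun x _ => Finset.sum_nonneg fun y _ => hc0 x y) (Finset.mem_univ x)) hB.le

omit [Fintype S] in
lemma Comparable.mono {B B' : ℝ} (hB : 0 < B) (hBB : B ≤ B') (hc0 : ∀ x y, 0 ≤ c x y)
    {k : S → S → ℝ} (h : Comparable c B k) : Comparable c B' k := fun x y =>
  ⟨(div_le_div_of_nonneg_left (hc0 x y) hB hBB).trans (h x y).1,
    (h x y).2.trans (mul_le_mul_of_nonneg_right hBB (hc0 x y))⟩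

/-- The oscillation of a function is controlled by its image under the generator, uniformly in
the rates. -/
lemma exists_osc_bound [Nonempty S] (hc0 : ∀ x y, 0 ≤ c x y) (hc : IsConnected c) {B : ℝ}
    (hB : 0 < B) :
    ∃ C : ℝ, 0 ≤ C ∧ ∀ k : S → S → ℝ, Comparable c B k → ∀ (f : S → ℝ) (γ : ℝ),
      (∀ x, |gen k f x| ≤ γ) → ∀ x y, |f x - f y| ≤ C * γ := by
  -- One-sided version from a maximum point x: all f_x - f_z are nonnegative, so at a state u the
  -- value of gen f and the drop f_x - f_u control the drop to each neighbour. Following a chain of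
  -- c keeps the constant independent of k.
  have key : ∀ x y, ∃ C : ℝ, 0 ≤ C ∧ ∀ k : S → S → ℝ, Comparable c B k → ∀ (f : S → ℝ) (γ : ℝ),
      0 ≤ γ → (∀ x, |gen k f x| ≤ γ) → (∀ z, f z ≤ f x) → f x - f y ≤ C * γ := by
    intro x y
    induction hc x y with
    | refl => exact ⟨0, le_rfl, by simp⟩
    | @tail u v _ huv ih =>
      obtain ⟨C, hC0, hC⟩ := ih
      set Λ := B * ∑ x, ∑ y, c x y
      have hΛ : 0 ≤ Λ := mul_nonneg hB.le
        (Finset.sum_nonneg fun x _ => Finset.sum_nonneg fun y _ => hc0 x y)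
      refine ⟨B / c u v * (Λ * C + 1), by positivity, fun k hk f γ hγ hg hmax => ?_⟩
      have hk0 := hk.nonneg hB hc0
      have h1 : ∑ z, k u z * (f x - f z) = (∑ z, k u z) * (f x - f u) - gen k f u := by
        simp only [gen, Finset.sum_mul, ← Finset.sum_sub_distrib]
        exact Finset.sum_congr rfl fun z _ => by ring
      have h2 : k u v * (f x - f v) ≤ ∑ z, k u z * (f x - f z) :=
        Finset.single_le_sum (f := fun z => k u z * (f x - f z))
          (fun z _ => mul_nonneg (hk0 u z) (sub_nonneg.2 (hmax z))) (Finset.mem_univ v)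
      have h3 : (∑ z, k u z) * (f x - f u) ≤ Λ * (C * γ) :=
        mul_le_mul (hk.sum_le hB hc0 u) (hC k hk f γ hγ hg hmax) (sub_nonneg.2 (hmax u)) hΛ
      have h4 : c u v / B * (f x - f v) ≤ k u v * (f x - f v) :=
        mul_le_mul_of_nonneg_right (hk u v).1 (sub_nonneg.2 (hmax v))
      have h5 : c u v / B * (f x - f v) ≤ (Λ * C + 1) * γ := by
        have := neg_le_of_abs_le (hg u)
        nlinarith
      calc f x - f v = B / c u v * (c u v / B * (f x - f v)) := by
            have := huv.ne'
            field_simp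
        _ ≤ B / c u v * ((Λ * C + 1) * γ) := by gcongr
        _ = _ := by ring
  choose C hC0 hC using key
  refine ⟨∑ x, ∑ y, C x y, Finset.sum_nonneg fun x _ => Finset.sum_nonneg fun y _ => hC0 x y,
    fun k hk f γ hg x y => ?_⟩
  obtain ⟨w, hw⟩ := Finite.exists_max f
  have hγ : 0 ≤ γ := (abs_nonneg _).trans (hg w)
  have h : ∀ z, f w - f z ≤ (∑ x, ∑ y, C x y) * γ := fun z =>
    (hC w z k hk f γ hγ hg hw).trans (mul_le_mul_of_nonneg_right
      ((Finset.single_le_sum (f := fun y => C w y) (fun y _ => hC0 w y) (Finset.mem_univ z)).trans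
        (Finset.single_le_sum (f := fun x => ∑ y, C x y)
          (fun x _ => Finset.sum_nonneg fun y _ => hC0 x y) (Finset.mem_univ w))) hγ)
  rw [abs_le]
  constructor <;> linarith [h x, h y, hw x, hw y]

lemma abs_le_of_mean_zero {ρ f : S → ℝ} {γ : ℝ} (hρ : ∀ x, 0 ≤ ρ x)
    (hρ1 : ∑ x, ρ x = 1) (hf : ∑ x, ρ x * f x = 0) (h : ∀ x y, |f x - f y| ≤ γ) (x : S) :
    |f x| ≤ γ := by
  have h1 : f x = ∑ y, ρ y * (f x - f y) := by
    simp only [mul_sub, Finset.sum_sub_distrib, hf, ← Finset.sum_mul, hρ1]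
    ring
  rw [h1]
  simpa using abs_sum_mul_le hρ hρ1.le ((abs_nonneg _).trans (h x x)) (h x)

/-- The Harnack inequality. -/
lemma exists_harnack [Nonempty S] (hc0 : ∀ x y, 0 ≤ c x y) (hc : IsConnected c) {B A : ℝ}
    (hB : 0 < B) (hA : 0 ≤ A) :
    ∃ K : ℝ, 1 ≤ K ∧ ∀ (k : S → S → ℝ) (f : S → ℝ), (∀ x y, c x y / B ≤ k x y) →
      (∀ x, 0 ≤ f x) → (∀ x, ∑ y, k x y * f y ≤ A * f x) → ∀ x y, f y ≤ K * f x := by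
  have key : ∀ x y, ∃ K : ℝ, 0 ≤ K ∧ ∀ (k : S → S → ℝ) (f : S → ℝ), (∀ x y, c x y / B ≤ k x y) →
      (∀ x, 0 ≤ f x) → (∀ x, ∑ y, k x y * f y ≤ A * f x) → f y ≤ K * f x := by
    intro x y
    induction hc x y with
    | refl => exact ⟨1, zero_le_one, by simp⟩
    | @tail u v _ huv ih =>
      obtain ⟨K, hK0, hK⟩ := ih
      refine ⟨B / c u v * (A * K), by positivity, fun k f hk hf h => ?_⟩
      have hk0 : ∀ x y, 0 ≤ k x y := fun x y => (div_nonneg (hc0 x y) hB.le).trans (hk x y)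
      -- For f ≥ 0 a single term of the sum at u is bounded by A f_u, so each step along the chain
      -- costs a fixed factor.
      have h1 : c u v / B * f v ≤ A * (K * f x) :=
        calc c u v / B * f v ≤ k u v * f v := mul_le_mul_of_nonneg_right (hk u v) (hf v)
          _ ≤ ∑ z, k u z * f z := Finset.single_le_sum (f := fun z => k u z * f z)
              (fun z _ => mul_nonneg (hk0 u z) (hf z)) (Finset.mem_univ v)
          _ ≤ A * f u := h u
          _ ≤ _ := mul_le_mul_of_nonneg_left (hK k f hk hf h) hA
      calc f v = B / c u v * (c u v / B * f v) := by
            have := huv.ne'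
            field_simp
        _ ≤ B / c u v * (A * (K * f x)) := by gcongr
        _ = _ := by ring
  choose K hK0 hK using key
  refine ⟨1 + ∑ x, ∑ y, K x y, ?_, fun k f hk hf h x y => ?_⟩
  · have := Finset.sum_nonneg fun x (_ : x ∈ Finset.univ) =>
      Finset.sum_nonneg fun y (_ : y ∈ Finset.univ) => hK0 x y
    linarith
  · refine (hK x y k f hk hf h).trans (mul_le_mul_of_nonneg_right ?_ (hf x))
    have := (Finset.single_le_sum (f := fun y => K x y) (fun y _ => hK0 x y)
      (Finset.mem_univ y)).trans (Finset.single_le_sum (f := fun x => ∑ y, K x y)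
          (fun x _ => Finset.sum_nonneg fun y _ => hK0 x y) (Finset.mem_univ x))
    linarith

/-- Uniform bounds for the Perron eigenvectors. -/
lemma exists_perron_bound [Nonempty S] (hc0 : ∀ x y, 0 ≤ c x y) (hc : IsConnected c) {B d : ℝ}
    (hB : 0 < B) (hd : 0 ≤ d) :
    ∃ M : ℝ, 1 ≤ M ∧ ∀ (k ψ : S → S → ℝ) (ρ l : S → ℝ) (μ : ℝ), Comparable c B k →
      (∀ x y, |ψ x y| ≤ d) → (∀ x, 0 ≤ ρ x) → ∑ x, ρ x = 1 → (∀ x, 0 < l x) →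
      ∑ x, ρ x * l x = 1 →
      (∀ x, ∑ y, k x y * Real.exp (-ψ x y / 2) * l y = (μ + ∑ y, k x y) * l x) →
      ∀ x, M⁻¹ ≤ l x ∧ l x ≤ M := by
  set Λ := B * ∑ x, ∑ y, c x y
  have hΛ : 0 ≤ Λ := mul_nonneg hB.le
    (Finset.sum_nonneg fun x _ => Finset.sum_nonneg fun y _ => hc0 x y)
  obtain ⟨K, hK1, hK⟩ := exists_harnack hc0 hc (B := B * Real.exp d)
    (A := Λ * Real.exp d + Λ) (by positivity) (by positivity)
  refine ⟨K, hK1, fun k ψ ρ l μ hk hψ hρ hρ1 hl hρl heig x => ?_⟩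
  have hk0 := hk.nonneg hB hc0
  have hz : ∀ x y, |-ψ x y / 2| ≤ d := fun x y => by
    rw [abs_div, abs_neg, abs_two]
    linarith [hψ x y, abs_nonneg (ψ x y)]
  -- Read the eigenvalue equation at a maximum of l. Then `A` bounds μ plus the escape rate, the
  -- Harnack inequality applies to l, and the normalisation Σ ρl = 1 turns bounds on ratios into
  -- bounds on values.
  have hμ : μ ≤ Λ * Real.exp d := by
    obtain ⟨w, hw⟩ := Finite.exists_max l
    have h1 : ∑ y, k w y * Real.exp (-ψ w y / 2) * l y ≤ Λ * Real.exp d * l w := by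
      calc _ ≤ ∑ y, k w y * Real.exp d * l w := Finset.sum_le_sum fun y _ => by
            have := (abs_le.1 (hz w y)).2
            have h3 := hk0 w y
            have h4 := (hl w).le
            have h5 := (hl y).le
            gcongr
            exact hw y
        _ = (∑ y, k w y) * Real.exp d * l w := by simp only [Finset.sum_mul]
        _ ≤ _ := by
          have := (hl w).le
          gcongr
          exact hk.sum_le hB hc0 w
    rw [heig] at h1
    have h2 := le_of_mul_le_mul_right h1 (hl w)
    have h3 : 0 ≤ ∑ y, k w y := Finset.sum_nonneg fun y _ => hk0 w y
    linarith
  have hH := hK (fun x y => k x y * Real.exp (-ψ x y / 2)) l (fun x y => ?_)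
    (fun x => (hl x).le) (fun x => ?_)
  · have hK0 : 0 < K := by linarith
    constructor
    · rw [inv_le_iff_one_le_mul₀' hK0, ← hρl]
      calc _ ≤ ∑ y, ρ y * (K * l x) := Finset.sum_le_sum fun y _ =>
            mul_le_mul_of_nonneg_left (hH x y) (hρ y)
        _ = _ := by rw [← Finset.sum_mul, hρ1, one_mul]
    · calc l x = ∑ y, ρ y * l x := by rw [← Finset.sum_mul, hρ1, one_mul]
        _ ≤ ∑ y, ρ y * (K * l y) := Finset.sum_le_sum fun y _ =>
            mul_le_mul_of_nonneg_left (hH y x) (hρ y)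
        _ = K * ∑ y, ρ y * l y := by
            rw [Finset.mul_sum]; exact Finset.sum_congr rfl fun y _ => by ring
        _ = K := by rw [hρl, mul_one]
  · have h1 := (abs_le.1 (hz x y)).1
    rw [← div_div, div_eq_mul_inv _ (Real.exp d), ← Real.exp_neg]
    have := hk0 x y
    gcongr
    exact (hk x y).1
  · rw [heig]
    have := (hl x).le
    gcongr
    exact hk.sum_le hB hc0 x

end Bounds

/-! ### Second-order expansion of the eigenvectors; the reversed rates -/

section Expansion

variable {S : Type*} [Fintype S]

/-- The second-order expansion of the Perron eigenvector of the biased rates. -/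
lemma exists_expansion {Λ C M m₀ d : ℝ} (hΛ : 0 ≤ Λ) (hC : 0 ≤ C) (hM : 0 ≤ M) (hm₀ : 0 ≤ m₀)
    (hd : 0 ≤ d) :
    ∃ D : ℝ, 0 ≤ D ∧ ∀ (k ψ : S → S → ℝ) (ρ V l : S → ℝ) (μ m δ : ℝ),
      (∀ x y, 0 ≤ k x y) → (∀ x, ∑ y, k x y ≤ Λ) → (∀ x, 0 ≤ ρ x) → ∑ x, ρ x = 1 →
      IsInvariant k ρ →
      (∀ (f : S → ℝ) (γ : ℝ), ∑ x, ρ x * f x = 0 → (∀ x, |gen k f x| ≤ γ) → ∀ x, |f x| ≤ C * γ) →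
      0 ≤ δ → δ ≤ d → (∀ x y, |ψ x y| ≤ δ) → |m| ≤ m₀ * δ ^ 2 →
      (∀ x, |l x| ≤ M) → ∑ x, ρ x * l x = 1 →
      (∀ x, ∑ y, k x y * Real.exp (-ψ x y / 2) * l y = (μ + ∑ y, k x y) * l x) →
      ∑ x, ρ x * V x = 0 → (∀ x, gen k V x = m - ∑ y, k x y * ψ x y) →
      (∀ x, |V x| ≤ D * δ) ∧ (∀ x, |l x - 1| ≤ D * δ) ∧
      (∀ x, |l x - 1 + 1 / 2 * V x| ≤ D * δ ^ 2) ∧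
      ∀ x, |gen k (fun y => l y - 1 + 1 / 2 * V y) x -
        (μ + m / 2 - ∑ y, k x y * (ψ x y ^ 2 / 8 + ψ x y * V y / 4))| ≤ D * δ ^ 3 := by
  -- `D1`, `DV` and `D2` bound l - 1, V and l - 1 + V/2 at their orders in δ; `G2` and `G3` bound
  -- the residuals of second and third order. Each `D` is `C` times the bound on the image under the
  -- generator.
  set E := Real.exp d with hE
  have hE0 : 0 ≤ E := (Real.exp_pos d).le
  set D1 := C * (Λ * E * M * (M + 1)) with hD1
  set DV := C * (m₀ * d + Λ) with hDV
  set G2 := Λ * E * M * D1 + Λ * (E * M + D1 / 2) with hG2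
  set D2 := C * (2 * G2) with hD2
  set G3 := (G2 + m₀ / 2) * D1 + Λ * (E * M + D1 / 8 + D2 / 2) with hG3
  have hD1' : 0 ≤ D1 := by positivity
  have hDV' : 0 ≤ DV := by positivity
  have hG2' : 0 ≤ G2 := by positivity
  have hD2' : 0 ≤ D2 := by positivity
  have hG3' : 0 ≤ G3 := by positivity
  refine ⟨D1 + DV + D2 + G3, by positivity, ?_⟩
  intro k ψ ρ V l μ m δ hk0 hkΛ hρ hρ1 hinv hosc hδ hδd hψ hm hl hρl heig hρV hV
  have hz : ∀ x y, |-ψ x y / 2| ≤ δ := fun x y => by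
    rw [abs_div, abs_neg, abs_two]
    linarith [hψ x y, abs_nonneg (ψ x y)]
  have hzd : ∀ x y, |-ψ x y / 2| ≤ d := fun x y => (hz x y).trans hδd
  have he : ∀ n x y, E * |-ψ x y / 2| ^ n ≤ E * δ ^ n := fun n x y =>
    mul_le_mul_of_nonneg_left (pow_le_pow_left₀ (abs_nonneg _) (hz x y) n) hE0
  have he1 : ∀ x y, |Real.exp (-ψ x y / 2) - 1| ≤ E * δ := fun x y => by
    have := (abs_exp_sub_sum_le (hzd x y) 1).trans (he 1 x y)
    simpa using this
  have he2 : ∀ x y, |Real.exp (-ψ x y / 2) - 1 - (-ψ x y / 2)| ≤ E * δ ^ 2 := fun x y => by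
    have := (abs_exp_sub_sum_le (hzd x y) 2).trans (he 2 x y)
    simpa [Finset.sum_range_succ, sub_sub] using this
  have he3 : ∀ x y, |Real.exp (-ψ x y / 2) - 1 - (-ψ x y / 2) - ψ x y ^ 2 / 8| ≤
      E * δ ^ 3 := fun x y => by
    have := (abs_exp_sub_sum_le (hzd x y) 3).trans (he 3 x y)
    convert! this using 2
    simp [Finset.sum_range_succ, Nat.factorial]
    ring
  -- the eigenvalue equation
  have hgl : ∀ x, gen k l x = μ * l x - ∑ y, k x y * ((Real.exp (-ψ x y / 2) - 1) * l y) := by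
    intro x
    have h1 : ∑ y, k x y * ((Real.exp (-ψ x y / 2) - 1) * l y) =
        ∑ y, k x y * Real.exp (-ψ x y / 2) * l y - ∑ y, k x y * l y := by
      rw [← Finset.sum_sub_distrib]
      exact Finset.sum_congr rfl fun y _ => by ring
    rw [h1, heig, gen_eq]
    ring
  have hA : ∀ x, |∑ y, k x y * ((Real.exp (-ψ x y / 2) - 1) * l y)| ≤ Λ * (E * δ * M) := fun x =>
    abs_sum_mul_le (hk0 x) (hkΛ x) (by positivity) fun y => abs_mul_le (he1 x y) (hl y)
  have hμ1 : |μ| ≤ Λ * E * M * δ := by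
    have h1 : μ = ∑ x, ρ x * ∑ y, k x y * ((Real.exp (-ψ x y / 2) - 1) * l y) := by
      have h2 := hinv.sum_mul_gen l
      simp only [hgl, mul_sub, Finset.sum_sub_distrib] at h2
      have h3 : ∑ x, ρ x * (μ * l x) = μ := by
        simp only [mul_left_comm _ μ, ← Finset.mul_sum, hρl, mul_one]
      linarith
    rw [h1]
    have := abs_sum_mul_le hρ hρ1.le (by positivity) hA
    linarith
  have hl1 : ∀ x, |l x - 1| ≤ D1 * δ := by
    have h1 : ∑ x, ρ x * (l x - 1) = 0 := by
      simp [mul_sub, Finset.sum_sub_distrib, hρl, hρ1]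
    have h2 : ∀ x, gen k (fun y => l y - 1) x = gen k l x := fun x => by simp [gen]
    intro x
    have h3 := hosc _ (Λ * E * M * (M + 1) * δ) h1 (fun x => by
      rw [h2, hgl]
      refine (abs_sub_le_of_le (abs_mul_le hμ1 (hl x)) (hA x)).trans (le_of_eq ?_)
      ring) x
    rw [hD1]
    linarith
  have hV1 : ∀ x, |V x| ≤ DV * δ := by
    intro x
    have h3 := hosc V ((m₀ * d + Λ) * δ) hρV (fun x => by
      rw [hV]
      refine (abs_sub_le_of_le hm (abs_sum_mul_le (hk0 x) (hkΛ x) hδ (hψ x))).trans ?_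
      have := mul_le_mul_of_nonneg_left hδd (mul_nonneg hm₀ hδ)
      nlinarith) x
    rw [hDV]
    linarith
  -- second order
  set l2 : S → ℝ := fun y => l y - 1 + 1 / 2 * V y with hl2
  have hρl2 : ∑ x, ρ x * l2 x = 0 := by
    have : ∀ x, ρ x * l2 x = ρ x * l x - ρ x + 1 / 2 * (ρ x * V x) := fun x => by
      simp only [hl2]; ring
    simp only [this, Finset.sum_add_distrib, Finset.sum_sub_distrib, ← Finset.mul_sum, hρl, hρ1,
      hρV]
    ring
  have hgl2 : ∀ x, gen k l2 x = gen k l x + 1 / 2 * gen k V x := fun x => by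
    rw [hl2, gen_add, gen_const_mul]
    simp [gen]
  -- The choice of V cancels the first-order source in the eigenvalue equation.
  have hsplit : ∀ x, gen k l2 x - (μ + m / 2) = μ * (l x - 1) -
      ∑ y, k x y * ((Real.exp (-ψ x y / 2) - 1 - (-ψ x y / 2)) * l y -
        ψ x y / 2 * (l y - 1)) := by
    intro x
    rw [hgl2, hgl, hV]
    have : ∑ y, k x y * ((Real.exp (-ψ x y / 2) - 1 - (-ψ x y / 2)) * l y -
        ψ x y / 2 * (l y - 1)) = ∑ y, k x y * ((Real.exp (-ψ x y / 2) - 1) * l y) +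
          1 / 2 * ∑ y, k x y * ψ x y := by
      rw [Finset.mul_sum, ← Finset.sum_add_distrib]
      exact Finset.sum_congr rfl fun y _ => by ring
    rw [this]
    ring
  have hψ2 : ∀ x y, |ψ x y / 2| ≤ δ / 2 := fun x y => by
    rw [abs_div, abs_two]; linarith [hψ x y]
  have hG2b : ∀ x, |gen k l2 x - (μ + m / 2)| ≤ G2 * δ ^ 2 := by
    intro x
    rw [hsplit]
    refine (abs_sub_le_of_le (abs_mul_le hμ1 (hl1 x)) (abs_sum_mul_le (hk0 x) (hkΛ x)
      (γ := E * δ ^ 2 * M + δ / 2 * (D1 * δ)) (by positivity) fun y =>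
      abs_sub_le_of_le (abs_mul_le (he2 x y) (hl y)) (abs_mul_le (hψ2 x y) (hl1 y)))).trans
      (le_of_eq ?_)
    rw [hG2]
    ring
  -- The image of the generator has ρ-mean zero, which fixes μ to be -m/2 up to second order. Since
  -- m is itself of second order, so is μ, which the third-order step needs.
  have hμm : |μ + m / 2| ≤ G2 * δ ^ 2 := by
    have h1 : μ + m / 2 = -∑ x, ρ x * (gen k l2 x - (μ + m / 2)) := by
      simp only [mul_sub, Finset.sum_sub_distrib, hinv.sum_mul_gen, ← Finset.sum_mul, hρ1]
      ring
    rw [h1, abs_neg]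
    simpa using abs_sum_mul_le hρ hρ1.le (by positivity) hG2b
  have hl2b : ∀ x, |l2 x| ≤ D2 * δ ^ 2 := by
    intro x
    have h3 := hosc l2 (2 * G2 * δ ^ 2) hρl2 (fun x => by
      have := abs_add_le_of_le (hG2b x) hμm
      rw [sub_add_cancel] at this
      linarith) x
    rw [hD2]
    linarith
  have hμ2 : |μ| ≤ (G2 + m₀ / 2) * δ ^ 2 := by
    have hm2 : |m / 2| ≤ m₀ / 2 * δ ^ 2 := by
      rw [abs_div, abs_two]; linarith
    have := abs_sub_le_of_le hμm hm2
    rw [add_sub_cancel_right] at this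
    linarith
  -- third order
  have hψ8 : ∀ x y, |ψ x y ^ 2 / 8| ≤ δ ^ 2 / 8 := fun x y => by
    rw [abs_div, abs_pow, abs_of_pos (by norm_num : (0 : ℝ) < 8)]
    have := pow_le_pow_left₀ (abs_nonneg _) (hψ x y) 2
    linarith
  have hG3b : ∀ x, |gen k l2 x -
      (μ + m / 2 - ∑ y, k x y * (ψ x y ^ 2 / 8 + ψ x y * V y / 4))| ≤ G3 * δ ^ 3 := by
    intro x
    have h1 : gen k l2 x - (μ + m / 2 - ∑ y, k x y * (ψ x y ^ 2 / 8 + ψ x y * V y / 4)) =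
        μ * (l x - 1) - ∑ y, k x y *
          ((Real.exp (-ψ x y / 2) - 1 - (-ψ x y / 2) - ψ x y ^ 2 / 8) * l y +
            ψ x y ^ 2 / 8 * (l y - 1) - ψ x y / 2 * l2 y) := by
      have h2 : ∑ y, k x y *
          ((Real.exp (-ψ x y / 2) - 1 - (-ψ x y / 2) - ψ x y ^ 2 / 8) * l y +
            ψ x y ^ 2 / 8 * (l y - 1) - ψ x y / 2 * l2 y) =
          ∑ y, k x y * ((Real.exp (-ψ x y / 2) - 1 - (-ψ x y / 2)) * l y -
            ψ x y / 2 * (l y - 1)) - ∑ y, k x y * (ψ x y ^ 2 / 8 + ψ x y * V y / 4) := by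
        rw [← Finset.sum_sub_distrib]
        exact Finset.sum_congr rfl fun y _ => by simp only [hl2]; ring
      rw [h2]
      linarith [hsplit x]
    rw [h1]
    refine (abs_sub_le_of_le (abs_mul_le hμ2 (hl1 x)) (abs_sum_mul_le (hk0 x) (hkΛ x)
      (γ := E * δ ^ 3 * M + δ ^ 2 / 8 * (D1 * δ) + δ / 2 * (D2 * δ ^ 2)) (by positivity) fun y =>
      abs_sub_le_of_le (abs_add_le_of_le (abs_mul_le (he3 x y) (hl y))
        (abs_mul_le (hψ8 x y) (hl1 y))) (abs_mul_le (hψ2 x y) (hl2b y)))).trans (le_of_eq ?_)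
    rw [hG3]
    ring
  refine ⟨fun x => (hV1 x).trans ?_, fun x => (hl1 x).trans ?_, fun x => (hl2b x).trans ?_,
    fun x => (hG3b x).trans ?_⟩ <;>
  · refine mul_le_mul_of_nonneg_right ?_ (by positivity)
    linarith

variable {c : S → S → ℝ}

/-- The time-reversed rates are comparable with `c`, and close to the original ones when the
detailed balance conditions are almost satisfied. -/
lemma exists_revRate_bound [Nonempty S] (hc0 : ∀ x y, 0 ≤ c x y) (hcs : ∀ x y, c x y = c y x)
    (hc : IsConnected c) {B d : ℝ} (hB : 1 ≤ B) :
    ∃ B' D : ℝ, B ≤ B' ∧ 0 ≤ D ∧ ∀ (k ψ : S → S → ℝ) (π ρ : S → ℝ) (δ : ℝ), Comparable c B k →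
      0 ≤ δ → δ ≤ d → (∀ x y, |ψ x y| ≤ δ) → (∀ x, B⁻¹ ≤ π x ∧ π x ≤ B) →
      (∀ x y, π x * k x y * Real.exp (-ψ x y) = π y * k y x) →
      (∀ x, 0 < ρ x) → IsInvariant k ρ →
      Comparable c B' (revRate k ρ) ∧ ∀ x y, |revRate k ρ x y - k x y| ≤ D * δ := by
  have hB0 : 0 < B := by linarith
  set Λ := B * ∑ x, ∑ y, c x y
  have hΛ : 0 ≤ Λ := mul_nonneg hB0.le
    (Finset.sum_nonneg fun x _ => Finset.sum_nonneg fun y _ => hc0 x y)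
  obtain ⟨K, hK1, hK⟩ := exists_harnack hc0 hc hB0 hΛ
  obtain ⟨C, hC0, hC⟩ := exists_osc_bound hc0 hc hB0
  have hK0 : 0 < K := by linarith
  set E := Real.exp d
  set K2 := B ^ 2 * K with hK2
  have hE0 : 0 ≤ E := (Real.exp_pos d).le
  have hK20 : 0 ≤ K2 := by positivity
  refine ⟨B * K, Λ * (E * K2 + C * (Λ * E * K2)), le_mul_of_one_le_right hB0.le hK1,
    by positivity, fun k ψ π ρ δ hk hδ hδd hψ hπ hdb hρ hinv => ?_⟩
  have hk0 := hk.nonneg hB0 hc0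
  have hkΛ := hk.sum_le hB0 hc0
  have hπ0 : ∀ x, 0 < π x := fun x => (inv_pos.2 hB0).trans_le (hπ x).1
  -- The balance equations are of Harnack type for the transposed rates, which are also comparable
  -- with c because c is symmetric.
  have hHρ : ∀ x y, ρ y ≤ K * ρ x := hK (fun x y => k y x) ρ
    (fun x y => by rw [hcs]; exact (hk y x).1) (fun x => (hρ x).le) (fun x => by
      have := hinv x
      calc ∑ y, k y x * ρ y = ∑ y, ρ y * k y x := Finset.sum_congr rfl fun y _ => mul_comm _ _
        _ = (∑ y, k x y) * ρ x := by rw [this, mul_comm]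
        _ ≤ _ := mul_le_mul_of_nonneg_right (hkΛ x) (hρ x).le)
  refine ⟨fun x y => ⟨?_, ?_⟩, fun x y => ?_⟩
  · rw [revRate, le_div_iff₀ (hρ x), ← div_div, hcs x y]
    calc c y x / B / K * ρ x ≤ k y x / K * ρ x := by
          have := (hρ x).le
          gcongr
          exact (hk y x).1
      _ ≤ k y x / K * (K * ρ y) := by
          have := hk0 y x
          gcongr
          exact hHρ y x
      _ = ρ y * k y x := by field_simp
  · rw [revRate, div_le_iff₀ (hρ x), hcs x y]
    calc ρ y * k y x ≤ (K * ρ x) * (B * c y x) :=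
          mul_le_mul (hHρ x y) (hk y x).2 (hk0 y x) (mul_nonneg hK0.le (hρ x).le)
      _ = _ := by ring
  -- For δ = 0 the vector π is reversible and ω is constant. In general gen ω = O(δ) relative to
  -- ω_x, so the oscillation bound makes ω nearly constant, and k' - k is expressed by this
  -- deviation and by exp(-ψ) - 1.
  · set ω : S → ℝ := fun x => ρ x / π x with hω
    have hω0 : ∀ x, 0 < ω x := fun x => div_pos (hρ x) (hπ0 x)
    have hωle : ∀ y, ω y ≤ K2 * ω x := by
      intro y
      have h1 : ω y ≤ B * ρ y := by
        rw [hω, div_le_iff₀ (hπ0 y)]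
        have h2 : 1 ≤ B * π y := by
          have := (hπ y).1
          rwa [inv_le_iff_one_le_mul₀' hB0] at this
        nlinarith [hρ y]
      have h2 : ρ x ≤ B * ω x := by
        have : ρ x = π x * ω x := by
          rw [hω]; have := (hπ0 x).ne'; field_simp
        rw [this]
        exact mul_le_mul_of_nonneg_right (hπ x).2 (hω0 x).le
      calc ω y ≤ B * ρ y := h1
        _ ≤ B * (K * ρ x) := by gcongr; exact hHρ x y
        _ ≤ B * (K * (B * ω x)) := by gcongr
        _ = _ := by rw [hK2]; ring
    have hψd : ∀ x y, |Real.exp (-ψ x y) - 1| ≤ E * δ := fun x y => by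
      have h1 : |-ψ x y| ≤ δ := by rw [abs_neg]; exact hψ x y
      have := abs_exp_sub_sum_le (h1.trans hδd) 1
      have h2 := mul_le_mul_of_nonneg_left h1 hE0
      simp only [Finset.range_one, Finset.sum_singleton, pow_zero, Nat.factorial_zero,
        Nat.cast_one, div_one, pow_one] at this
      exact this.trans h2
    have hgω : ∀ z, gen k ω z = -∑ y, k z y * ((Real.exp (-ψ z y) - 1) * ω y) := by
      intro z
      have h1 : ∑ y, k z y * Real.exp (-ψ z y) * ω y = (∑ y, k z y) * ω z := by
        have h2 := hinv z
        have h3 : ∑ y, ρ y * k y z = π z * ∑ y, k z y * Real.exp (-ψ z y) * ω y := by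
          rw [Finset.mul_sum]
          refine Finset.sum_congr rfl fun y _ => ?_
          have h4 := hdb z y
          have h5 := (hπ0 y).ne'
          simp only [hω]
          field_simp
          linear_combination (-ρ y) * h4
        rw [h3] at h2
        have h5 := (hπ0 z).ne'
        refine mul_left_cancel₀ h5 (h2.trans ?_)
        simp only [hω]
        field_simp
      rw [gen_eq, ← h1, ← Finset.sum_sub_distrib, ← Finset.sum_neg_distrib]
      exact Finset.sum_congr rfl fun y _ => by ring
    have hosc := hC k hk ω (Λ * (E * δ * (K2 * ω x))) (fun z => by
      rw [hgω, abs_neg]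
      refine abs_sum_mul_le (hk0 z) (hkΛ z)
        (mul_nonneg (mul_nonneg hE0 hδ) (mul_nonneg hK20 (hω0 x).le)) fun y =>
        abs_mul_le (hψd z y) ?_
      rw [abs_of_pos (hω0 y)]
      exact hωle y) y x
    have hrw : revRate k ρ x y - k x y = k x y *
        ((Real.exp (-ψ x y) - 1) * (ω y / ω x) + (ω y - ω x) / ω x) := by
      have h4 := hdb x y
      have h5 := (hπ0 y).ne'
      have h6 := (hπ0 x).ne'
      have h7 := (hρ x).ne'
      simp only [revRate, hω]
      field_simp
      linear_combination (-ρ y) * h4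
    rw [hrw]
    have hkxy : |k x y| ≤ Λ := by
      rw [abs_of_nonneg (hk0 x y)]
      exact (Finset.single_le_sum (f := fun y => k x y) (fun y _ => hk0 x y)
        (Finset.mem_univ y)).trans (hkΛ x)
    have h1 : |ω y / ω x| ≤ K2 := by
      rw [abs_of_pos (div_pos (hω0 y) (hω0 x)), div_le_iff₀ (hω0 x)]
      exact hωle y
    have h2 : |(ω y - ω x) / ω x| ≤ C * (Λ * E * K2) * δ := by
      rw [abs_div, abs_of_pos (hω0 x), div_le_iff₀ (hω0 x)]
      refine hosc.trans (le_of_eq ?_)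
      ring
    refine (abs_mul_le hkxy (abs_add_le_of_le (abs_mul_le (hψd x y) h1) h2)).trans (le_of_eq ?_)
    ring

end Expansion

/-! ### Time-reversal symmetry of the second-order terms -/

section Expansion

variable {S : Type*} [Fintype S] {c : S → S → ℝ}

/-- The second-order terms of the Perron eigenvectors of the process and of its time reversal
agree up to the third order. -/
theorem exists_cubic_bound [Nonempty S] (hc0 : ∀ x y, 0 ≤ c x y) (hcs : ∀ x y, c x y = c y x)
    (hc : IsConnected c) {B d : ℝ} (hB : 1 ≤ B) (hd : 0 ≤ d) :
    ∃ C₀ : ℝ, 0 ≤ C₀ ∧ ∀ (k ψ : S → S → ℝ) (π ρ l q V U : S → ℝ) (μ m δ : ℝ),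
      Comparable c B k → 0 ≤ δ → δ ≤ d → (∀ x y, |ψ x y| ≤ δ) → (∀ x y, ψ y x = -ψ x y) →
      (∀ x, B⁻¹ ≤ π x ∧ π x ≤ B) →
      (∀ x y, π x * k x y * Real.exp (-ψ x y) = π y * k y x) →
      (∀ x, 0 < ρ x) → ∑ x, ρ x = 1 → IsInvariant k ρ →
      (∀ x, 0 < l x) → (∀ x, 0 < q x) → ∑ x, ρ x * l x = 1 → ∑ x, ρ x * q x = 1 →
      (∀ x, ∑ y, k x y * Real.exp (-ψ x y / 2) * l y = (μ + ∑ y, k x y) * l x) →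
      (∀ x, ∑ y, revRate k ρ x y * Real.exp (-ψ y x / 2) * q y =
        (μ + ∑ y, revRate k ρ x y) * q x) →
      ∑ x, ρ x * V x = 0 → ∑ x, ρ x * U x = 0 → m = ∑ x, ρ x * ∑ y, k x y * ψ x y →
      (∀ x, gen k V x = m - ∑ y, k x y * ψ x y) →
      (∀ x, gen (revRate k ρ) U x = m - ∑ y, revRate k ρ x y * ψ y x) →
      ∀ x, |Real.log (l x) - Real.log (q x) + 1 / 2 * (V x - U x)| ≤ C₀ * δ ^ 3 := by
  obtain ⟨B', D1, hBB, hD1, hrev⟩ := exists_revRate_bound hc0 hcs hc (d := d) hB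
  have hB0 : 0 < B := by linarith
  have hB0' : 0 < B' := by linarith
  set Λ := B' * ∑ x, ∑ y, c x y
  have hΛ : 0 ≤ Λ := mul_nonneg hB0'.le
    (Finset.sum_nonneg fun x _ => Finset.sum_nonneg fun y _ => hc0 x y)
  obtain ⟨C, hC0, hC⟩ := exists_osc_bound hc0 hc hB0'
  obtain ⟨M, hM1, hM⟩ := exists_perron_bound hc0 hc hB0' hd
  obtain ⟨CL, hCL0, hCL⟩ := exists_abs_log_sub_le M hM1
  set n : ℝ := (Fintype.card S : ℝ) with hn
  have hn0 : 0 ≤ n := Nat.cast_nonneg _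
  have hM0 : 0 ≤ M := by linarith
  obtain ⟨D2, hD2, hexp⟩ := exists_expansion (S := S) (m₀ := n * D1) hΛ hC0 hM0
    (by positivity) hd
  set G4 := 2 * (n * D1) + n * D1 + n * (D1 * (2 * D2)) with hG4
  set G5 := 2 * D2 + n * (D1 * (1 / 8 + D2 / 4)) + Λ * (C * G4 / 4) + n * (D1 * (2 * D2)) with hG5
  have hG40 : 0 ≤ G4 := by positivity
  have hG50 : 0 ≤ G5 := by positivity
  refine ⟨2 * (CL * D2 ^ 3) + C * G5 + D2 * (2 * D2 + C * G4 / 2), by positivity, ?_⟩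
  intro k ψ π ρ l q V U μ m δ hk hδ hδd hψ hψa hπ hdb hρ hρ1 hinv hl hq hρl hρq hel heq hρV hρU
    hm hV hU
  obtain ⟨hk', hkk⟩ := hrev k ψ π ρ δ hk hδ hδd hψ hπ hdb hρ hinv
  set k' := revRate k ρ with hk'def
  have hkB := hk.mono hB0 hBB hc0
  have hinv' : IsInvariant k' ρ := isInvariant_revRate hρ hinv
  have hρ0 : ∀ x, 0 ≤ ρ x := fun x => (hρ x).le
  have hk0 := hkB.nonneg hB0' hc0
  have hkΛ := hkB.sum_le hB0' hc0
  have hk0' := hk'.nonneg hB0' hc0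
  have hkΛ' := hk'.sum_le hB0' hc0
  have hosc : ∀ k, Comparable c B' k → ∀ (f : S → ℝ) (γ : ℝ), ∑ x, ρ x * f x = 0 →
      (∀ x, |gen k f x| ≤ γ) → ∀ x, |f x| ≤ C * γ := fun k hk f γ hf hg =>
    abs_le_of_mean_zero hρ0 hρ1 hf (hC k hk f γ hg)
  have hψ' : ∀ x y, |ψ y x| ≤ δ := fun x y => hψ y x
  -- the mean entropy production is of the second order
  have hmb : |m| ≤ n * D1 * δ ^ 2 := by
    -- Reversal changes the sign of the current, so 2m is a mean of (k - k')ψ, a product of two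
    -- first-order quantities.
    have h1 : ∑ x, ρ x * ∑ y, k' x y * ψ x y = -m := by
      rw [hm, ← Finset.sum_neg_distrib]
      simp only [Finset.mul_sum, ← Finset.sum_neg_distrib]
      rw [Finset.sum_comm]
      refine Finset.sum_congr rfl fun x _ => Finset.sum_congr rfl fun y _ => ?_
      have := (hρ y).ne'
      rw [hk'def, revRate, hψa x y]
      field_simp
    have h2 : 2 * m = -∑ x, ρ x * ∑ y, (k' x y - k x y) * ψ x y := by
      simp only [sub_mul, Finset.sum_sub_distrib, mul_sub, h1, ← hm]
      ring
    have h3 := abs_sum_mul_le hρ0 hρ1.le (γ := n * (D1 * δ * δ)) (by positivity) fun x =>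
      abs_sum_mul_le_card (hkk x) (hψ x)
    rw [← abs_neg, ← h2, abs_mul, abs_two] at h3
    nlinarith [abs_nonneg m]
  have hlM := hM k ψ ρ l μ hkB (fun x y => (hψ x y).trans hδd) hρ0 hρ1 hl hρl hel
  have hqM := hM k' (fun x y => ψ y x) ρ q μ hk' (fun x y => (hψ y x).trans hδd) hρ0 hρ1 hq hρq heq
  have hlabs : ∀ x, |l x| ≤ M := fun x => by rw [abs_of_pos (hl x)]; exact (hlM x).2
  have hqabs : ∀ x, |q x| ≤ M := fun x => by rw [abs_of_pos (hq x)]; exact (hqM x).2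
  obtain ⟨hV1, hl1, hl2, hl3⟩ := hexp k ψ ρ V l μ m δ hk0 hkΛ hρ0 hρ1 hinv (hosc k hkB) hδ hδd hψ
    hmb hlabs hρl hel hρV hV
  obtain ⟨hU1, hq1, hq2, hq3⟩ := hexp k' (fun x y => ψ y x) ρ U q μ m δ hk0' hkΛ' hρ0 hρ1 hinv'
    (hosc k' hk') hδ hδd hψ' hmb hqabs hρq heq hρU hU
  set l2 : S → ℝ := fun y => l y - 1 + 1 / 2 * V y with hl2def
  set q2 : S → ℝ := fun y => q y - 1 + 1 / 2 * U y with hq2def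
  have hgsub : ∀ (f : S → ℝ) x, gen k f x = gen k' f x - ∑ y, (k' x y - k x y) * (f y - f x) := by
    intro f x
    simp only [gen, ← Finset.sum_sub_distrib]
    exact Finset.sum_congr rfl fun y _ => by ring
  -- The sources of V and U are opposite to leading order because ψ is antisymmetric; what remains
  -- carries m or k' - k times a first-order quantity.
  have hVU : ∀ x, |V x + U x| ≤ C * G4 * δ ^ 2 := by
    intro x
    have h1 := hosc k hkB (fun x => V x + U x) (G4 * δ ^ 2)
      (by simp only [mul_add, Finset.sum_add_distrib, hρV, hρU, add_zero]) (fun x => by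
        have h2 : gen k (fun x => V x + U x) x = 2 * m + ∑ y, (k' x y - k x y) * ψ x y -
            ∑ y, (k' x y - k x y) * (U y - U x) := by
          rw [gen_add, hV, hgsub U, hU]
          simp only [hψa x, sub_mul _ _ (ψ x _), Finset.sum_sub_distrib, mul_neg,
            Finset.sum_neg_distrib]
          ring
        rw [h2]
        have h3 : |2 * m| ≤ 2 * (n * D1 * δ ^ 2) := by
          rw [abs_mul, abs_two]; linarith
        refine (abs_sub_le_of_le (abs_add_le_of_le h3 (abs_sum_mul_le_card (hkk x) (hψ x)))
          (abs_sum_mul_le_card (hkk x) fun y => abs_sub_le_of_le (hU1 y) (hU1 x))).trans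
          (le_of_eq ?_)
        rw [hG4]
        ring) x
    linarith
  have hlq : ∀ x, |l2 x - q2 x| ≤ C * G5 * δ ^ 3 := by
    intro x
    have hmean : ∑ x, ρ x * (l2 x - q2 x) = 0 := by
      have : ∀ x, ρ x * (l2 x - q2 x) = ρ x * l x - ρ x * q x +
          1 / 2 * (ρ x * V x - ρ x * U x) := fun x => by
        simp only [hl2def, hq2def]; ring
      simp only [this, Finset.sum_add_distrib, Finset.sum_sub_distrib, ← Finset.mul_sum, hρl, hρq,
        hρV, hρU]
      ring
    have h1 := hosc k hkB (fun x => l2 x - q2 x) (G5 * δ ^ 3) hmean (fun x => by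
      -- The sources of l₂ and q₂ contain the same μ + m/2, the same ψ²/8, and ψ_xy V against ψ_yx U
      -- = -ψ_xy U, which agree up to V + U. Every displayed term is of third order.
      have h2 : gen k (fun x => l2 x - q2 x) x =
          (gen k l2 x - (μ + m / 2 - ∑ y, k x y * (ψ x y ^ 2 / 8 + ψ x y * V y / 4))) -
          (gen k' q2 x - (μ + m / 2 - ∑ y, k' x y * (ψ y x ^ 2 / 8 + ψ y x * U y / 4))) +
          ∑ y, (k' x y - k x y) * (ψ x y ^ 2 / 8 - ψ x y * (U y / 4)) -
          ∑ y, k x y * (ψ x y * ((V y + U y) / 4)) +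
          ∑ y, (k' x y - k x y) * (q2 y - q2 x) := by
        have h3 : ∑ y, (k' x y - k x y) * (ψ x y ^ 2 / 8 - ψ x y * (U y / 4)) -
            ∑ y, k x y * (ψ x y * ((V y + U y) / 4)) =
            ∑ y, k' x y * (ψ y x ^ 2 / 8 + ψ y x * U y / 4) -
            ∑ y, k x y * (ψ x y ^ 2 / 8 + ψ x y * V y / 4) := by
          rw [← Finset.sum_sub_distrib, ← Finset.sum_sub_distrib]
          exact Finset.sum_congr rfl fun y _ => by rw [hψa x y]; ring
        rw [gen_sub, hgsub q2]
        linear_combination (-1 : ℝ) * h3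
      rw [h2]
      have hψ8 : ∀ y, |ψ x y ^ 2 / 8| ≤ δ ^ 2 / 8 := fun y => by
        rw [abs_div, abs_pow, abs_of_pos (by norm_num : (0 : ℝ) < 8)]
        have := pow_le_pow_left₀ (abs_nonneg _) (hψ x y) 2
        linarith
      have hU4 : ∀ y, |U y / 4| ≤ D2 * δ / 4 := fun y => by
        rw [abs_div, abs_of_pos (by norm_num : (0 : ℝ) < 4)]
        linarith [hU1 y]
      have hVU4 : ∀ y, |(V y + U y) / 4| ≤ C * G4 * δ ^ 2 / 4 := fun y => by
        rw [abs_div, abs_of_pos (by norm_num : (0 : ℝ) < 4)]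
        linarith [hVU y]
      refine (abs_add_le_of_le (abs_sub_le_of_le (abs_add_le_of_le (abs_sub_le_of_le (hl3 x)
        (hq3 x)) (abs_sum_mul_le_card (hkk x) fun y => abs_sub_le_of_le (hψ8 y)
          (abs_mul_le (hψ x y) (hU4 y))))
        (abs_sum_mul_le (hk0 x) (hkΛ x) (γ := δ * (C * G4 * δ ^ 2 / 4)) (by positivity)
          fun y => abs_mul_le (hψ x y) (hVU4 y)))
        (abs_sum_mul_le_card (hkk x) fun y => abs_sub_le_of_le (hq2 y) (hq2 x))).trans
          (le_of_eq ?_)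
      rw [hG5]
      ring) x
    linarith
  intro x
  -- The difference of the squares factors through (l - 1) + (q - 1) = l₂ + q₂ - (V + U)/2, which is
  -- of second order, and (l - 1) - (q - 1), which is of first order.
  have h1 : Real.log (l x) - Real.log (q x) + 1 / 2 * (V x - U x) =
      (Real.log (l x) - (l x - 1) + (l x - 1) ^ 2 / 2) -
      (Real.log (q x) - (q x - 1) + (q x - 1) ^ 2 / 2) + (l2 x - q2 x) -
      ((l x - 1) - (q x - 1)) * ((l2 x + q2 x - (V x + U x) / 2) / 2) := by
    simp only [hl2def, hq2def]
    ring
  have hll : |Real.log (l x) - (l x - 1) + (l x - 1) ^ 2 / 2| ≤ CL * (D2 * δ) ^ 3 :=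
    (hCL _ (hlM x).1 (hlM x).2).trans
      (mul_le_mul_of_nonneg_left (pow_le_pow_left₀ (abs_nonneg _) (hl1 x) 3) hCL0)
  have hlq' : |Real.log (q x) - (q x - 1) + (q x - 1) ^ 2 / 2| ≤ CL * (D2 * δ) ^ 3 :=
    (hCL _ (hqM x).1 (hqM x).2).trans
      (mul_le_mul_of_nonneg_left (pow_le_pow_left₀ (abs_nonneg _) (hq1 x) 3) hCL0)
  have hVU2 : |(V x + U x) / 2| ≤ C * G4 * δ ^ 2 / 2 := by
    rw [abs_div, abs_two]; linarith [hVU x]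
  have hsum : |(l2 x + q2 x - (V x + U x) / 2) / 2| ≤
      (D2 * δ ^ 2 + D2 * δ ^ 2 + C * G4 * δ ^ 2 / 2) / 2 := by
    rw [abs_div, abs_two]
    have := abs_sub_le_of_le (abs_add_le_of_le (hl2 x) (hq2 x)) hVU2
    simp only [hl2def, hq2def]
    linarith
  rw [h1]
  refine (abs_sub_le_of_le (abs_add_le_of_le (abs_sub_le_of_le hll hlq') (hlq x))
    (abs_mul_le (abs_sub_le_of_le (hl1 x) (hq1 x)) hsum)).trans (le_of_eq ?_)
  ring

end Expansion

/-! ### The given class of rates -/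

section Model

variable {S : Type*}

/-- The choice of equilibrium rates enters only through the antisymmetric part and the size of the
exponent w, so both rules are treated at once. -/
lemma eqRate_eq (rule : EqRule) (c : S → S → ℝ) {β Ebar : ℝ} (hβ : 0 < β) {H : S → ℝ}
    (hH : ∀ x, |H x| ≤ Ebar) :
    ∃ w : S → S → ℝ, (∀ x y, eqRate rule c β H x y = c x y * Real.exp (w x y)) ∧
      (∀ x y, w x y - w y x = β * (H x - H y)) ∧ ∀ x y, |w x y| ≤ β * |Ebar| := by
  have hE : ∀ x, |H x| ≤ |Ebar| := fun x => (hH x).trans (le_abs_self _)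
  cases rule with
  | exponential =>
    refine ⟨fun x _ => β * H x, fun x y => rfl, fun x y => by ring, fun x y => ?_⟩
    rw [abs_mul, abs_of_pos hβ]
    exact mul_le_mul_of_nonneg_left (hE x) hβ.le
  | symmetric =>
    refine ⟨fun x y => β / 2 * (H x - H y), fun x y => rfl, fun x y => by ring, fun x y => ?_⟩
    rw [abs_mul, abs_of_pos (half_pos hβ)]
    have := mul_le_mul_of_nonneg_left (abs_sub_le_of_le (hE x) (hE y)) (half_pos hβ).le
    linarith

lemma isInvariant_of_mulVec [Fintype S] [DecidableEq S] {R : S → S → ℝ} {ρ : S → ℝ} :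
    (rateMatrix R).mulVec ρ = 0 ↔ IsInvariant (offDiag R) ρ := by
  rw [funext_iff, IsInvariant]
  refine forall_congr' fun y => ?_
  have h : (rateMatrix R).mulVec ρ y =
      ∑ x, ρ x * offDiag R x y - ρ y * ∑ x, offDiag R y x := by
    rw [sum_offDiag]
    have h1 : ∀ x, rateMatrix R y x * ρ x =
        ρ x * offDiag R x y - if x = y then ρ y * escapeRate R y else 0 := by
      intro x
      simp only [rateMatrix, Matrix.of_apply, offDiag]
      split_ifs with hxy
      · subst hxy; ring
      · ring
    simp only [Matrix.mulVec, dotProduct, h1, Finset.sum_sub_distrib, Finset.sum_ite_eq',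
      Finset.mem_univ, if_true]
  rw [h, Pi.zero_apply, sub_eq_zero]

lemma le_and_le_of_abs_le {c B v b : ℝ} (hc : 0 ≤ c) (hB : B = Real.exp b) (hv : |v| ≤ b) :
    c / B ≤ c * Real.exp v ∧ c * Real.exp v ≤ B * c := by
  have h := abs_le.1 hv
  rw [hB]
  constructor
  · rw [div_eq_mul_inv, ← Real.exp_neg]
    exact mul_le_mul_of_nonneg_left (Real.exp_le_exp.2 h.1) hc
  · rw [mul_comm]
    exact mul_le_mul_of_nonneg_right (Real.exp_le_exp.2 h.2) hc

end Model

end NESS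

end

/-! ### Assembly of the representation -/

theorem mainTheorem4 {S : Type*} [Fintype S] [DecidableEq S] [Nonempty S]
    (c : S → S → ℝ) (hc : NESS.IsConnectivity c) (rule : NESS.EqRule)
    (β : ℝ) (hβ : 0 < β) (Ebar εmax : ℝ) :
    ∃ C₀ : ℝ, 0 < C₀ ∧
      ∀ {N K : Type*} (H : N → S → ℝ) (ξ : K → S → S → ℝ),
        (∀ ν x, |H ν x| ≤ Ebar) →
        (∀ κ x y, x ≠ y → c x y ≠ 0 → |ξ κ x y| ≤ 1) →
        ∀ (ε : ℝ) (ν : N) (κ : K), 0 ≤ ε → ε ≤ εmax →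
          let R : S → S → ℝ := NESS.rate rule c β ε (H ν) (ξ κ)
          let Ψ : NESS.JumpPath S → ℝ := NESS.Psi R β (H ν)
          ∃ ρ : S → ℝ, NESS.IsStationaryDistribution R ρ ∧
            (∀ ρ' : S → ℝ, NESS.IsStationaryDistribution R ρ' → ρ' = ρ) ∧
            (∀ x, 0 < ρ x) ∧
            ∃ F : ℝ, NESS.IsFreeEnergy R β (H ν) ρ F ∧
              ∀ x : S, ∃ L : ℝ,
                Tendsto
                  (fun τ : ℝ => NESS.expFrom R (-τ) τ x Ψ - NESS.expStTo R ρ (-τ) τ x Ψ)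
                  atTop (𝓝 L) ∧
                |Real.log (ρ x) - (β * F - β * H ν x - 1 / 2 * L)| ≤ C₀ * ε ^ 3 := by
  open NESS in
  have hc0 : ∀ x y, 0 ≤ offDiag c x y := offDiag_nonneg hc.nonneg
  have hcs : ∀ x y, offDiag c x y = offDiag c y x := by
    intro x y
    rcases eq_or_ne x y with rfl | h
    · rfl
    · simp only [offDiag, if_neg h, if_neg h.symm, hc.symm x y h]
  have hcpos : ∀ u v, u ≠ v ∧ c u v ≠ 0 → 0 < offDiag c u v := by
    rintro u v ⟨h1, h2⟩
    simp only [offDiag, if_neg h1]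
    exact lt_of_le_of_ne (hc.nonneg u v h1) h2.symm
  have hcc : IsConnected (offDiag c) := fun x y =>
    Relation.ReflTransGen.mono hcpos x y (hc.connected x y)
  set b : ℝ := |εmax| + β * |Ebar| with hb
  have hb0 : 0 ≤ b := by positivity
  set B : ℝ := Real.exp b with hB
  have hB1 : 1 ≤ B := Real.one_le_exp hb0
  have hB0 : 0 < B := Real.exp_pos b
  obtain ⟨C, hC0, hC⟩ := exists_cubic_bound hc0 hcs hcc hB1 (d := 2 * |εmax|) (by positivity)
  -- The expansion parameter is δ = 2ε, since ψ is a difference of two terms of size ε; the 1 makes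
  -- the constant strictly positive.
  refine ⟨8 * C + 1, by positivity, ?_⟩
  intro N K H ξ hH hξ ε ν κ hε hεm R Ψ
  have hεabs : ε ≤ |εmax| := hεm.trans (le_abs_self _)
  obtain ⟨w, hw1, hw2, hw3⟩ := eqRate_eq rule c hβ (hH ν)
  set h := H ν
  have hRx : ∀ x y, R x y = c x y * Real.exp (ε * ξ κ x y + w x y) := fun x y => by
    show Real.exp (ε * ξ κ x y) * eqRate rule c β h x y = _
    rw [hw1, Real.exp_add]
    ring
  have hR : ∀ x y, x ≠ y → 0 ≤ R x y := fun x y hxy => by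
    rw [hRx]; exact mul_nonneg (hc.nonneg x y hxy) (Real.exp_pos _).le
  set k := offDiag R with hk
  -- the entropy production at the allowed jumps
  set ξ' : S → S → ℝ := fun x y => if x = y ∨ c x y = 0 then 0 else ξ κ x y with hξ'
  have hξ'1 : ∀ x y, |ξ' x y| ≤ 1 := by
    intro x y
    simp only [hξ']
    split_ifs with h
    · simp
    · push Not at h
      exact hξ κ x y h.1 h.2
  -- A version of the nonequilibrium entropy production that is antisymmetric and bounded at all
  -- pairs; it agrees with Θ wherever a jump is possible, the only place where Θ is weighed.
  set ψ : S → S → ℝ := fun x y => ε * (ξ' x y - ξ' y x) with hψ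
  have hψb : ∀ x y, |ψ x y| ≤ 2 * ε := by
    intro x y
    rw [hψ, abs_mul, abs_of_nonneg hε]
    have := mul_le_mul_of_nonneg_left (abs_sub_le_of_le (hξ'1 x y) (hξ'1 y x)) hε
    linarith
  have hψa : ∀ x y, ψ y x = -ψ x y := fun x y => by simp only [hψ]; ring
  set Θ := noneqEntropyProduction R β h with hΘ
  have hkz : ∀ x y, (x = y ∨ c x y = 0) → k x y = 0 := by
    intro x y hxy
    simp only [hk, offDiag]
    split_ifs with h1
    · rfl
    · rw [hRx, hxy.resolve_left h1, zero_mul]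
  have hΘψ : ∀ x y, ¬(x = y ∨ c x y = 0) → Θ x y = ψ x y := by
    intro x y hxy
    have hxy' : ¬(y = x ∨ c y x = 0) := by
      rintro (h1 | h1)
      · exact hxy (Or.inl h1.symm)
      · push Not at hxy
        exact hxy.2 (by rw [hc.symm x y hxy.1, h1])
    simp only [hΘ, noneqEntropyProduction, entropyProduction, hψ, hξ', if_neg hxy, if_neg hxy']
    push Not at hxy
    rw [hRx, hRx, ← hc.symm x y hxy.1, mul_div_mul_left _ _ hxy.2, ← Real.exp_sub, Real.log_exp]
    linarith [hw2 x y]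
  have hkΘ : ∀ (f : ℝ → ℝ) x y, k x y * f (Θ x y) = k x y * f (ψ x y) := by
    intro f x y
    by_cases hxy : x = y ∨ c x y = 0
    · rw [hkz x y hxy, zero_mul, zero_mul]
    · rw [hΘψ x y hxy]
  have hkc : Comparable (offDiag c) B k := by
    intro x y
    by_cases hxy : x = y
    · simp [hk, offDiag, hxy]
    by_cases hcz : c x y = 0
    · simp [hk, offDiag, hxy, hRx, hcz]
    · simp only [hk, offDiag, if_neg hxy, hRx]
      refine le_and_le_of_abs_le (hc.nonneg x y hxy) hB (abs_add_le_of_le ?_ (hw3 x y))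
      rw [abs_mul, abs_of_nonneg hε]
      have := mul_le_mul_of_nonneg_left (hξ κ x y hxy hcz) hε
      linarith
  have hk0 : ∀ x y, 0 ≤ k x y := offDiag_nonneg hR
  have hkpos : ∀ u v, 0 < offDiag c u v → 0 < k u v := fun u v huv =>
    (div_pos huv hB0).trans_le (hkc u v).1
  have hkconn : IsConnected k := fun x y => Relation.ReflTransGen.mono hkpos x y (hcc x y)
  set π : S → ℝ := fun x => Real.exp (-β * h x) with hπ
  have hπ0 : ∀ x, 0 < π x := fun x => Real.exp_pos _
  have hπB : ∀ x, B⁻¹ ≤ π x ∧ π x ≤ B := by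
    intro x
    have h1 : |-β * h x| ≤ b := by
      rw [abs_mul, abs_neg, abs_of_pos hβ]
      have := mul_le_mul_of_nonneg_left ((hH ν x).trans (le_abs_self Ebar)) hβ.le
      have h2 := abs_nonneg εmax
      linarith
    simpa [hπ] using le_and_le_of_abs_le zero_le_one hB h1
  have hdb : ∀ x y, π x * k x y * Real.exp (-ψ x y) = π y * k y x := by
    intro x y
    by_cases hxy : x = y ∨ c x y = 0
    · have hxy' : y = x ∨ c y x = 0 := by
        rcases eq_or_ne x y with h1 | h1
        · exact Or.inl h1.symm
        · exact Or.inr (by rw [← hc.symm x y h1]; exact hxy.resolve_left h1)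
      rw [hkz x y hxy, hkz y x hxy']
      ring
    · have hne : x ≠ y := fun h1 => hxy (Or.inl h1)
      have hcz : c x y ≠ 0 := fun h1 => hxy (Or.inr h1)
      have hxy' : ¬(y = x ∨ c y x = 0) := by
        rw [← hc.symm x y hne]
        exact fun h1 => hxy (h1.imp_left Eq.symm)
      have hψxy : ψ x y = ε * (ξ κ x y - ξ κ y x) := by
        simp only [hψ, hξ', if_neg hxy, if_neg hxy']
      simp only [hk, offDiag, if_neg hne, if_neg hne.symm, hRx, hψxy, hπ, ← hc.symm x y hne]
      have e : ∀ a b d e : ℝ, Real.exp a * (d * Real.exp b) * Real.exp e =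
          d * Real.exp (a + b + e) := fun a b d e => by
        rw [Real.exp_add, Real.exp_add]; ring
      have e2 : ∀ a b d : ℝ, Real.exp a * (d * Real.exp b) = d * Real.exp (a + b) :=
        fun a b d => by rw [Real.exp_add]; ring
      rw [e, e2]
      congr 2
      linarith [hw2 x y]
  -- the stationary distribution
  obtain ⟨ρ, hρ, hρ1, hinv⟩ := exists_invariant hk0 hkconn
  refine ⟨ρ, ⟨fun x => (hρ x).le, hρ1, isInvariant_of_mulVec.2 hinv⟩, fun ρ' hρ' =>
    hinv.unique hk0 hkconn hρ hρ1 hρ'.sum_eq_one (isInvariant_of_mulVec.1 hρ'.stationary), hρ, ?_⟩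
  -- the Perron eigenvectors
  have htilt : ∀ x y, tilted R Θ x y = k x y * Real.exp (-ψ x y / 2) := fun x y =>
    hkΘ (fun z => Real.exp (-z / 2)) x y
  -- Half of the entropy production turns detailed balance with a defect exp(-ψ) into exact symmetry
  -- with respect to π.
  have hts : ∀ x y, π x * (k x y * Real.exp (-ψ x y / 2)) =
      π y * (k y x * Real.exp (-ψ y x / 2)) := by
    intro x y
    rw [← mul_assoc (π y), ← hdb x y, hψa x y, mul_assoc _ (Real.exp _), ← Real.exp_add, mul_assoc]
    congr 3
    ring
  obtain ⟨l', μ, hl', heig'⟩ := exists_perron (π := π)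
    (M := fun x y => k x y * Real.exp (-ψ x y / 2) - if x = y then escapeRate R x else 0) hπ0
    (fun x y hxy => by
      simp only [if_neg hxy, sub_zero]
      exact mul_nonneg (hk0 x y) (Real.exp_pos _).le)
    (fun x y => Relation.ReflTransGen.mono (fun u v huv => ⟨huv.1, by
      simp only [if_neg huv.1, sub_zero]
      exact mul_pos (hkpos u v (hcpos u v huv)) (Real.exp_pos _)⟩) x y (hc.connected x y))
    (fun x y => by
      rcases eq_or_ne x y with rfl | hxy
      · rfl
      · simp only [if_neg hxy, if_neg hxy.symm, sub_zero]
        exact hts x y)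
  set z := ∑ x, ρ x * l' x with hz
  have hz0 : 0 < z := Finset.sum_pos (fun x _ => mul_pos (hρ x) (hl' x)) Finset.univ_nonempty
  set l : S → ℝ := fun x => l' x / z with hl
  have hl0 : ∀ x, 0 < l x := fun x => div_pos (hl' x) hz0
  have hρl : ∑ x, ρ x * l x = 1 := by
    simp only [hl, ← mul_div_assoc, ← Finset.sum_div]
    exact div_self hz0.ne'
  have heig : ∀ x, ∑ y, k x y * Real.exp (-ψ x y / 2) * l y = (μ + escapeRate R x) * l x := by
    intro x
    have h1 := heig' x
    simp only [sub_mul, ite_mul, zero_mul, Finset.sum_sub_distrib, Finset.sum_ite_eq,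
      Finset.mem_univ, if_true] at h1
    simp only [hl, ← mul_div_assoc, ← Finset.sum_div]
    rw [sub_eq_iff_eq_add.1 h1]
    ring
  set Z := ∑ x, π x * l x with hZ
  have hZ0 : 0 < Z := Finset.sum_pos (fun x _ => mul_pos (hπ0 x) (hl0 x)) Finset.univ_nonempty
  -- Symmetry with respect to π makes πl a left eigenvector for the same μ.
  set r : S → ℝ := fun x => π x * l x / Z with hr
  have hr0 : ∀ x, 0 < r x := fun x => div_pos (mul_pos (hπ0 x) (hl0 x)) hZ0
  have hr1 : ∑ x, r x = 1 := by
    simp only [hr, ← Finset.sum_div]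
    exact div_self hZ0.ne'
  have heigr : ∀ x, ∑ y, r y * (k y x * Real.exp (-ψ y x / 2)) =
      (μ + escapeRate R x) * r x := by
    intro x
    calc _ = ∑ y, π x / Z * (k x y * Real.exp (-ψ x y / 2) * l y) :=
          Finset.sum_congr rfl fun y _ => by
            have h1 := hts x y
            simp only [hr]
            linear_combination (-(l y / Z)) * h1
      _ = _ := by rw [← Finset.mul_sum, heig]; simp only [hr]; ring
  -- Dividing by ρ turns a left eigenvector into a right eigenvector for the reversed rates.
  set q : S → ℝ := fun x => r x / ρ x with hq
  have hq0 : ∀ x, 0 < q x := fun x => div_pos (hr0 x) (hρ x)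
  have hρq : ∑ x, ρ x * q x = 1 := by
    rw [← hr1]
    exact Finset.sum_congr rfl fun x _ => mul_div_cancel₀ _ (hρ x).ne'
  have heigq : ∀ x, ∑ y, revRate k ρ x y * Real.exp (-ψ y x / 2) * q y =
      (μ + ∑ y, revRate k ρ x y) * q x := by
    intro x
    rw [sum_revRate hρ hinv, sum_offDiag]
    calc _ = (∑ y, r y * (k y x * Real.exp (-ψ y x / 2))) / ρ x := by
          rw [Finset.sum_div]
          refine Finset.sum_congr rfl fun y _ => ?_
          have := (hρ y).ne'
          simp only [revRate, hq]
          field_simp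
      _ = _ := by rw [heigr]; simp only [hq]; ring
  -- the solutions of the Poisson equations
  set m := ∑ x, ρ x * ∑ y, k x y * ψ x y with hm
  have hrev0 : ∀ x y, 0 ≤ revRate k ρ x y := fun x y =>
    div_nonneg (mul_nonneg (hρ y).le (hk0 y x)) (hρ x).le
  have hrevc : IsConnected (revRate k ρ) := fun x y =>
    Relation.ReflTransGen.mono (fun u v huv => div_pos (mul_pos (hρ v)
      (hkpos v u (by rw [hcs]; exact huv))) (hρ u)) x y (hcc x y)
  have hinvr := isInvariant_revRate hρ hinv
  obtain ⟨V, hV0, hV⟩ := exists_gen_eq hk0 hkconn hρ hρ1 hinv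
    (g := fun x => m - ∑ y, k x y * ψ x y) (by
      simp only [mul_sub, Finset.sum_sub_distrib, ← Finset.sum_mul, hρ1, ← hm]; ring)
  have hmr : ∑ x, ρ x * ∑ y, revRate k ρ x y * ψ y x = m := by
    rw [hm]
    simp only [Finset.mul_sum]
    rw [Finset.sum_comm]
    refine Finset.sum_congr rfl fun x _ => Finset.sum_congr rfl fun y _ => ?_
    have := (hρ y).ne'
    simp only [revRate]
    field_simp
  obtain ⟨U, hU0, hU⟩ := exists_gen_eq hrev0 hrevc hρ hρ1 hinvr
    (g := fun x => m - ∑ y, revRate k ρ x y * ψ y x) (by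
      simp only [mul_sub, Finset.sum_sub_distrib, ← Finset.sum_mul, hρ1, hmr]; ring)
  have hVΘ : ∀ x, gen k V x = m - ∑ y, k x y * Θ x y := fun x => by
    rw [hV]
    congr 1
    exact Finset.sum_congr rfl fun y _ => (hkΘ id x y).symm
  have hUΘ : ∀ x, gen (revRate k ρ) U x = m - ∑ y, revRate k ρ x y * Θ y x := fun x => by
    rw [hU]
    congr 1
    refine Finset.sum_congr rfl fun y _ => ?_
    have h1 : k y x * Θ y x = k y x * ψ y x := hkΘ id y x
    simp only [revRate]
    linear_combination (-(ρ y / ρ x)) * h1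
  have hexpF : Real.exp (-β * (-Real.log Z / β)) = Z := by
    have : -β * (-Real.log Z / β) = Real.log Z := by field_simp
    rw [this, Real.exp_log hZ0]
  -- With Σ r = 1 and Σ ρl = 1 the limiting ratio times π_x is π_x l_x / r_x = Z, independently of
  -- x.
  refine ⟨-Real.log Z / β, fun x => ?_, fun x => ⟨V x - U x, ?_, ?_⟩⟩
  · have h1 := (tendsto_ratio (ψ := Θ) (μ := μ) hR hkconn hρ hl0 hr0
      (fun x => by simp only [htilt]; exact heig x)
      (fun x => by simp only [htilt]; exact heigr x) x).const_mul (π x)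
    have h2 : π x * (l x * ∑ y, r y) / (r x * ∑ y, ρ y * l y) = Z := by
      have := (hπ0 x).ne'
      have := (hl0 x).ne'
      rw [hr1, hρl]
      simp only [hr]
      field_simp
    rw [← mul_div_assoc, h2, ← hexpF] at h1
    exact h1
  · exact tendsto_expFrom_sub_expStTo hR hkconn hρ hρ1 hinv hV0 hU0 hVΘ hUΘ x
  · have h1 := hC k ψ π ρ l q V U μ m (2 * ε) hkc (by linarith) (by linarith) hψb hψa hπB hdb hρ
      hρ1 hinv hl0 hq0 hρl hρq (fun x => by rw [sum_offDiag]; exact heig x) heigq hV0 hU0 hm hV hU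
      x
    -- The exact representation ρ = r/q = πl/(Zq); only log l - log q is left to approximate.
    have h2 : Real.log (ρ x) = Real.log (π x) + Real.log (l x) - Real.log Z - Real.log (q x) := by
      have h3 : ρ x = π x * l x / Z / q x := by
        have h4 := (hr0 x).ne'
        have h5 := (hρ x).ne'
        show ρ x = r x / (r x / ρ x)
        field_simp
      rw [h3, Real.log_div (hr0 x).ne' (hq0 x).ne', Real.log_div
        (mul_pos (hπ0 x) (hl0 x)).ne' hZ0.ne', Real.log_mul (hπ0 x).ne' (hl0 x).ne']
    have h3 : Real.log (ρ x) - (β * (-Real.log Z / β) - β * h x - 1 / 2 * (V x - U x)) =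
        Real.log (l x) - Real.log (q x) + 1 / 2 * (V x - U x) := by
      rw [h2, mul_div_cancel₀ _ hβ.ne']
      simp only [hπ, Real.log_exp]
      ring
    rw [h3]
    refine h1.trans ?_
    have : 0 ≤ ε ^ 3 := by positivity
    nlinarith
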